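/- **Setting.** A three-user deterministic interference channel (DIC) has finite alphabets and, for $i\in\{1,2,3\}$, maps $V_i=g_i(X_i)$ and $Y_i=f_i(X_i,(V_j)_{j\ne i})$, where $X_i$ is sent by source $i$ and $Y_i$ is received by destination $i$; it is assumed that the interference can be recovered: $(V_j)_{j\neq i}=h_i(X_i,Y_i)$ for some function $h_i$. A code of block length $n$ and rate tuple $R=(R_1,R_2,R_3)$ has message sets of size $\lceil 2^{nR_i}\rceil$, encoders from messages to $\mathcal X_i^n$ and decoders from $\mathcal Y_i^n$ to messages; $P_e$ is the probability, for independent uniform messages, that some destination decodes wrongly. $R\in\mathbb R_{\ge0}^3$ is achievable if for every $\epsilon>0$ there are codes of rate $R$ with $P_e\le\epsilon$ for arbitrarily large $n$; the capacity region is the closure of the set of achievable tuples. $H$ is entropy in bits. An extended network with $m_i$ copies of user $i$ has users $v$ that are copies of the three users; a copy $v$ of user $i$ receives $f_i(X_v,(g_j(X_{c_j(v)}))_{j\ne i})$, where for each $j\neq i$ one copy $c_j(v)$ of user $j$ is chosen; all copies of user $i$ use the code of user $i$, with independent messages $W_v$. An admissible cut sequence is a sequence of node sets $\Omega_0\supseteq\Omega_1\supseteq\dots\supseteq\Omega_{L+1}=\emptyset$,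 with $\Omega_0$ the set of all sources $s_v$ and destinations $d_v$, such that $d_v\in\Omega_l\iff s_v\in\Omega_{l+1}$ for all $v$ and $0\le l\le L$. Its generalized cut-set (GCS) expression is $$G=H(Y^n_{\Omega_1^c})+\sum_{l=2}^{L}H\big(Y^n_{\Omega_l^c\cap\Omega_{l-1}}\,\big|\,W_{\mathcal S\setminus\Omega_l},Y^n_{\Omega_{l-1}^c}\big).$$ **The bounds.** (1) $R_1\le H(Y_1|V_2V_3)$; (2) $R_1+R_2\le H(Y_1|V_1V_2V_3)+H(Y_2|V_3)$; (3) $R_1+R_2\le H(Y_1|V_1V_3)+H(Y_2|V_2V_3)$; (4) $2R_1+R_2\le H(Y_1|V_3)+H(Y_1|V_1V_2V_3)+H(Y_2|V_2V_3)$; (5) $R_1+R_2+R_3\le H(Y_1|V_1)+H(Y_2|V_2V_3)+H(Y_3|V_1V_2V_3)$; (6) $R_1+R_2+R_3\le H(Y_1|V_1V_3)+H(Y_2|V_1V_2)+H(Y_3|V_2V_3)$; (7) $R_1+R_2+R_3\le H(Y_1|V_1V_2V_3)+H(Y_2|V_1)+H(Y_3|V_2V_3)$; (8) $R_1+R_2+R_3\le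 H(Y_1|V_1V_2V_3)+H(Y_2|V_1V_2V_3)+H(Y_3)$; (9) $2R_1+R_2+R_3\le H(Y_1)+H(Y_1|V_1V_2V_3)+H(Y_2|V_2V_3)+H(Y_3|V_1V_2V_3)$; (10) $2R_1+R_2+R_3\le H(Y_1|V_1)+H(Y_1|V_1V_2V_3)+H(Y_2|V_2V_3)+H(Y_3|V_2V_3)$; (11) $2R_1+R_2+R_3\le H(Y_1|V_1V_3)+H(Y_1|V_2)+H(Y_2|V_1V_2V_3)+H(Y_3|V_2V_3)$; (12) $2R_1+R_2+R_3\le H(Y_1|V_1V_2V_3)+H(Y_1|V_3)+H(Y_2|V_1V_2)+H(Y_3|V_2V_3)$; (13) $2R_1+R_2+R_3\le H(Y_1|V_1V_2V_3)+H(Y_1|V_3)+H(Y_2|V_2)+H(Y_3|V_1V_2V_3)$; (14) $2R_1+R_2+R_3\le H(Y_1|V_1V_2V_3)+H(Y_1|V_1V_2)+H(Y_2|V_2V_3)+H(Y_3|V_3)$; (15) $2R_1+R_2+R_3\le 2H(Y_1|V_1V_2V_3)+H(Y_2)+H(Y_3|V_2V_3)$; (16) $2R_1+R_2+R_3\le 2H(Y_1|V_1V_2V_3)+H(Y_2|V_2)+H(Y_3|V_3)$;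 (17) $3R_1+R_2+R_3\le 2H(Y_1|V_1V_2V_3)+H(Y_1)+H(Y_2|V_2V_3)+H(Y_3|V_2V_3)$; (18) $3R_1+R_2+R_3\le 2H(Y_1|V_1V_2V_3)+H(Y_1|V_2)+H(Y_2|V_2V_3)+H(Y_3|V_3)$; (19) $2R_1+2R_2+R_3\le H(Y_1)+H(Y_1|V_1V_3)+2H(Y_2|V_1V_2V_3)+H(Y_3|V_2V_3)$; (20) $2R_1+2R_2+R_3\le H(Y_1)+H(Y_1|V_1V_2V_3)+H(Y_2|V_1V_2V_3)+H(Y_2|V_2V_3)+H(Y_3|V_1V_3)$; (21) $2R_1+2R_2+R_3\le H(Y_1)+H(Y_1|V_1V_2V_3)+2H(Y_2|V_1V_2V_3)+H(Y_3|V_3)$; (22) $2R_1+2R_2+R_3\le H(Y_1|V_1)+H(Y_1|V_1V_2V_3)+H(Y_2|V_1V_2V_3)+H(Y_2|V_2V_3)+H(Y_3|V_3)$; (23) $2R_1+2R_2+R_3\le 2H(Y_1|V_1V_3)+H(Y_2|V_1V_2V_3)+H(Y_2|V_2)+H(Y_3|V_2V_3)$; (24) $3R_1+2R_2+R_3\le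 2H(Y_1|V_1V_2V_3)+H(Y_1)+H(Y_2|V_1V_2V_3)+H(Y_2|V_2V_3)+H(Y_3|V_3)$; (25) $3R_1+2R_2+R_3\le 2H(Y_1|V_1V_2V_3)+H(Y_1)+2H(Y_2|V_2V_3)+H(Y_3|V_1V_3)$; (26) $3R_1+2R_2+R_3\le 2H(Y_1|V_1V_2V_3)+H(Y_1|V_1)+2H(Y_2|V_2V_3)+H(Y_3|V_3)$; (27) $3R_1+2R_2+R_3\le 3H(Y_1|V_1V_2V_3)+H(Y_2|V_2V_3)+H(Y_2)+H(Y_3|V_3)$; (28) $4R_1+2R_2+R_3\le 3H(Y_1|V_1V_2V_3)+H(Y_1)+2H(Y_2|V_2V_3)+H(Y_3|V_3)$. Also consider the bounds obtained from these by any permutation of the users $1,2,3$. Write a bound as $\sum_i a_iR_i\le B$. Call it *direct* if its number is one of 8, 9, 15, 17, 19, 20, 21, 24, 25, 27, 28, and a *limit* bound otherwise. **Theorem.** For every three-user DIC the following holds. (A) For each of the bounds and each integer $k\ge0$ there are an extended network, with $a_i$ copies of user $i$ if the bound is direct and $ka_i+1$ copies if it is a limit bound, and an admissible cut sequence in it,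 such that: 1. for every code, if $B[t]$ denotes $B$ evaluated at $(X_i[t],V_i[t],Y_i[t])_{i}$, the letters at time $t$ of the code on the original channel, then $G\le\sum_{t=1}^nB[t]$ if the bound is direct, and $G\le k\sum_{t=1}^nB[t]+\sum_{t=1}^n\big(H(Y_1[t])+H(Y_2[t])+H(Y_3[t])\big)$ if it is a limit bound; 2. for every $R\in\mathbb R_{\ge0}^3$ and every sequence of codes of rate $R$ with block lengths $n\to\infty$ and $P_e\to0$ on the original channel, the error probability of the replicated codes on the extended network also tends to $0$, and $n\sum_i m_iR_i\le G+n\epsilon_n$ with $\epsilon_n\to0$, where $m_i$ is the number of copies of user $i$. (B) Consequently all the bounds hold on the capacity region: for every $R$ in the capacity region there are a finite time-sharing variable $Q$ and a distribution $p(q)p(x_1|q)p(x_2|q)p(x_3|q)$ for which $R$ satisfies all 28 bounds, and all those obtained from them by permuting the users, with every entropy on the right conditioned on $Q$ in addition. -/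

import Mathlib

open Filter Topology

/-! Users 1, 2, 3 are the elements 0, 1, 2 of `Fin 3`. -/

/-! ### Discrete entropy (in bits) -/

/-- Probability of the event `s` under the weights `p` on a finite sample space. -/
noncomputable def probOf {Ω : Type*} [Fintype Ω] (p : Ω → ℝ) (s : Set Ω) : ℝ :=
  ∑ ω, s.indicator p ω

/-- Uniform distribution on a finite set. -/
noncomputable def uniformLaw (Ω : Type*) [Fintype Ω] : Ω → ℝ :=
  fun _ => (Fintype.card Ω : ℝ)⁻¹

/-- Conditional entropy `H(A | B) = - ∑ P(a, b) log₂ P(a | b)` of random variables `A`, `B` on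
the finite probability space `(Ω, p)`. When `B` is constant this is the entropy `H(A)`. -/
noncomputable def condEntropy {Ω α β : Type*} [Fintype Ω] [Fintype α] [Fintype β]
    (p : Ω → ℝ) (A : Ω → α) (B : Ω → β) : ℝ :=
  -∑ a, ∑ b, probOf p {ω | A ω = a ∧ B ω = b} *
    Real.logb 2 (probOf p {ω | A ω = a ∧ B ω = b} / probOf p {ω | B ω = b})

/-! ### The three-user deterministic interference channel -/

/-- The three-user deterministic interference channel: `V_i = g_i(X_i)`,
`Y_i = f_i(X_i, (V_j)_{j ≠ i})`, and receiver `i` can recover the two interference signals from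
`(X_i, Y_i)` through `h_i`. -/
structure DIC (X V Y : Fin 3 → Type*) where
  f : ∀ i, X i → (∀ j : {j : Fin 3 // j ≠ i}, V j) → Y i
  g : ∀ i, X i → V i
  h : ∀ i, X i → Y i → (∀ j : {j : Fin 3 // j ≠ i}, V j)
  recover : ∀ (i : Fin 3) (x : ∀ j, X j),
    h i (x i) (f i (x i) fun j => g j (x j)) = fun j : {j : Fin 3 // j ≠ i} => g j (x j)

/-- The received symbol `Y_i` when the transmitted symbols are `x`. -/
def DIC.output {X V Y : Fin 3 → Type*} (N : DIC X V Y) (x : ∀ i, X i) (i : Fin 3) : Y i :=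
  N.f i (x i) fun j => N.g j (x j)

/-- `H(Y_i | V_T)` where `V_T = (V_j)_{j ∈ T}` and the inputs `X_1, X_2, X_3` are independent
with `X_i ∼ p i`. -/
noncomputable def DIC.termEntropy {X V Y : Fin 3 → Type*} [∀ i, Fintype (X i)]
    [∀ i, Fintype (V i)] [∀ i, Fintype (Y i)] (N : DIC X V Y) (p : ∀ i, X i → ℝ)
    (i : Fin 3) (T : Finset (Fin 3)) : ℝ :=
  condEntropy (fun x : ∀ i, X i => ∏ i, p i (x i)) (fun x => N.output x i)
    (fun x (j : T) => N.g j (x j))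

/-! ### Codes and the capacity region -/

/-- Size `⌈2^{nr}⌉` of the message set of a user with rate `r` at block length `n`. -/
noncomputable def numMessages (n : ℕ) (r : ℝ) : ℕ := ⌈(2 : ℝ) ^ ((n : ℝ) * r)⌉₊

/-- A coding scheme of block length `n` and rate tuple `R`. -/
structure Code (X Y : Fin 3 → Type*) (n : ℕ) (R : Fin 3 → ℝ) where
  enc : ∀ i, Fin (numMessages n (R i)) → Fin n → X i
  dec : ∀ i, (Fin n → Y i) → Fin (numMessages n (R i))

/-- Probability that some receiver decodes its message wrongly, the messages being independent
and uniform. -/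
noncomputable def DIC.errorProb {X V Y : Fin 3 → Type*} (N : DIC X V Y) {n : ℕ}
    {R : Fin 3 → ℝ} (C : Code X Y n R) : ℝ :=
  probOf (uniformLaw (∀ i, Fin (numMessages n (R i))))
    {w | ∃ i, C.dec i (fun t => N.output (fun j => C.enc j (w j) t) i) ≠ w i}

/-- The law of the transmitted symbol `X_i[t]` induced by the code. -/
noncomputable def Code.inputLaw {X Y : Fin 3 → Type*} {n : ℕ} {R : Fin 3 → ℝ}
    (C : Code X Y n R) (t : Fin n) (i : Fin 3) (x : X i) : ℝ :=
  probOf (uniformLaw (Fin (numMessages n (R i)))) {w | C.enc i w t = x}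

/-- Achievable rate tuples. -/
def DIC.IsAchievable {X V Y : Fin 3 → Type*} (N : DIC X V Y) (R : Fin 3 → ℝ) : Prop :=
  (∀ i, 0 ≤ R i) ∧ ∀ ε : ℝ, 0 < ε → ∀ n₀ : ℕ, ∃ n, n₀ ≤ n ∧
    ∃ C : Code X Y n R, N.errorProb C ≤ ε

/-- The capacity region: the closure of the set of achievable rate tuples. -/
def DIC.capacityRegion {X V Y : Fin 3 → Type*} (N : DIC X V Y) : Set (Fin 3 → ℝ) :=
  closure {R | N.IsAchievable R}

/-! ### Extended networks and the generalized cut-set bound -/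

/-- The users of an extended network with `m i` copies of user `i`. -/
abbrev ExtUser (m : Fin 3 → ℕ) := Σ i : Fin 3, Fin (m i)

/-- An extended network: each copy of user `i` gets interference from exactly one copy
`src v j` of each other user `j`. -/
structure ExtendedNetwork (m : Fin 3 → ℕ) where
  src : ∀ (v : ExtUser m) (j : {j : Fin 3 // j ≠ v.1}), Fin (m j)

/-- The symbol received by the copy `v` in the extended version of `N`. -/
def ExtendedNetwork.output {X V Y : Fin 3 → Type*} {m : Fin 3 → ℕ} (E : ExtendedNetwork m)
    (N : DIC X V Y) (x : ∀ v : ExtUser m, X v.1) (v : ExtUser m) : Y v.1 :=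
  N.f v.1 (x v) fun j => N.g j (x ⟨j, E.src v j⟩)

/-- The block `Y_v^n` received by `v` for the messages `w` when all copies of user `i` use the
encoder of user `i`. -/
def ExtendedNetwork.recv {X V Y : Fin 3 → Type*} {m : Fin 3 → ℕ} (E : ExtendedNetwork m)
    (N : DIC X V Y) {n : ℕ} {R : Fin 3 → ℝ} (C : Code X Y n R)
    (w : ∀ v : ExtUser m, Fin (numMessages n (R v.1))) (v : ExtUser m) : Fin n → Y v.1 :=
  fun t => E.output N (fun u => C.enc u.1 (w u) t) v

/-- Error probability of the replicated code on the extended network; the messages of different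
copies are independent. -/
noncomputable def ExtendedNetwork.errorProb {X V Y : Fin 3 → Type*} {m : Fin 3 → ℕ}
    (E : ExtendedNetwork m) (N : DIC X V Y) {n : ℕ} {R : Fin 3 → ℝ} (C : Code X Y n R) : ℝ :=
  probOf (uniformLaw (∀ v : ExtUser m, Fin (numMessages n (R v.1))))
    {w | ∃ v, C.dec v.1 (E.recv N C w v) ≠ w v}

/-- A nested cut sequence `Ω_0 ⊇ Ω_1 ⊇ ⋯ ⊇ Ω_{len+1}` admissible in the generalized cut-set
bound. The nodes are the sources `Sum.inl v` and the destinations `Sum.inr v`. -/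
structure CutSequence (m : Fin 3 → ℕ) where
  len : ℕ
  cut : ℕ → Finset (ExtUser m ⊕ ExtUser m)
  first : cut 0 = Finset.univ
  last : cut (len + 1) = ∅
  nested : ∀ l ≤ len, cut (l + 1) ⊆ cut l
  linked : ∀ l ≤ len, ∀ v, Sum.inr v ∈ cut l ↔ Sum.inl v ∈ cut (l + 1)

/-- The generalized cut-set expression
`∑_{l=1}^{len} H(Y^n_{Ω_l^c ∩ Ω_{l-1}} | W_{S ∖ Ω_l}, Y^n_{Ω_{l-1}^c})`
of a deterministic network. (No source lies outside `Ω_1` and no destination outside `Ω_0`, so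
the first term is `H(Y^n_{Ω_1^c})`.) -/
noncomputable def ExtendedNetwork.gcs {X V Y : Fin 3 → Type*} [∀ i, Fintype (Y i)]
    {m : Fin 3 → ℕ} (E : ExtendedNetwork m) (N : DIC X V Y) {n : ℕ} {R : Fin 3 → ℝ}
    (C : Code X Y n R) (Ω : CutSequence m) : ℝ :=
  ∑ l ∈ Finset.range Ω.len,
    condEntropy (uniformLaw (∀ v : ExtUser m, Fin (numMessages n (R v.1))))
      (fun w (v : {v : ExtUser m // Sum.inr v ∈ Ω.cut l ∧ Sum.inr v ∉ Ω.cut (l + 1)}) =>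
        E.recv N C w v.1)
      (fun w =>
        ((fun v : {v : ExtUser m // Sum.inl v ∉ Ω.cut (l + 1)} => w v.1),
          (fun v : {v : ExtUser m // Sum.inr v ∉ Ω.cut l} => E.recv N C w v.1)))

/-! ### The outer bounds -/

/-- The inequality `∑ i, rate i * R_i ≤ ∑_{(i, T) ∈ terms} H(Y_i | V_T)`. The flag `viaLimit` says
whether it is obtained from a family of extended networks indexed by `k → ∞` or from a single
one. -/
structure OuterBound where
  rate : Fin 3 → ℕ
  terms : List (Fin 3 × Finset (Fin 3))
  viaLimit : Bool

/-- The same bound with user `i` renamed to user `σ i`. -/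
def OuterBound.relabel (b : OuterBound) (σ : Equiv.Perm (Fin 3)) : OuterBound where
  rate := fun i => b.rate (σ.symm i)
  terms := b.terms.map fun t => (σ t.1, t.2.map σ.toEmbedding)
  viaLimit := b.viaLimit

/-- The right-hand side for independent inputs `X_i ∼ p i`. -/
noncomputable def OuterBound.rhs {X V Y : Fin 3 → Type*} [∀ i, Fintype (X i)]
    [∀ i, Fintype (V i)] [∀ i, Fintype (Y i)] (b : OuterBound) (N : DIC X V Y)
    (p : ∀ i, X i → ℝ) : ℝ :=
  (b.terms.map fun t => N.termEntropy p t.1 t.2).sum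

/-- Number of copies of user `i` in the (`k`-th) extended network for the bound. -/
def OuterBound.copies (b : OuterBound) (k : ℕ) (i : Fin 3) : ℕ :=
  if b.viaLimit then k * b.rate i + 1 else b.rate i

/-- The single-letter upper bound on the generalized cut-set expression of the (`k`-th) extended
network: `∑_t k * rhs[t] + ∑_t (H(Y_1[t]) + H(Y_2[t]) + H(Y_3[t]))` for the bounds obtained in the
limit, and `∑_t rhs[t]` for the others. -/
noncomputable def OuterBound.singleLetter {X V Y : Fin 3 → Type*} [∀ i, Fintype (X i)]
    [∀ i, Fintype (V i)] [∀ i, Fintype (Y i)] (b : OuterBound) (N : DIC X V Y) (k : ℕ)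
    {n : ℕ} {R : Fin 3 → ℝ} (C : Code X Y n R) : ℝ :=
  if b.viaLimit then
    ∑ t, k * b.rhs N (C.inputLaw t) + ∑ t, ∑ i, N.termEntropy (C.inputLaw t) i ∅
  else ∑ t, b.rhs N (C.inputLaw t)

/-- The 28 outer bounds; for instance the second one is
`R_1 + R_2 ≤ H(Y_1 | V_1 V_2 V_3) + H(Y_2 | V_3)`. -/
def outerBounds : List OuterBound :=
  [
    ⟨![1, 0, 0], [(0, {1, 2})], true⟩,
    ⟨![1, 1, 0], [(0, {0, 1, 2}), (1, {2})], true⟩,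
    ⟨![1, 1, 0], [(0, {0, 2}), (1, {1, 2})], true⟩,
    ⟨![2, 1, 0], [(0, {2}), (0, {0, 1, 2}), (1, {1, 2})], true⟩,
    ⟨![1, 1, 1], [(0, {0}), (1, {1, 2}), (2, {0, 1, 2})], true⟩,
    ⟨![1, 1, 1], [(0, {0, 2}), (1, {0, 1}), (2, {1, 2})], true⟩,
    ⟨![1, 1, 1], [(0, {0, 1, 2}), (1, {0}), (2, {1, 2})], true⟩,
    ⟨![1, 1, 1], [(0, {0, 1, 2}), (1, {0, 1, 2}), (2, ∅)], false⟩,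
    ⟨![2, 1, 1], [(0, ∅), (0, {0, 1, 2}), (1, {1, 2}), (2, {0, 1, 2})], false⟩,
    ⟨![2, 1, 1], [(0, {0}), (0, {0, 1, 2}), (1, {1, 2}), (2, {1, 2})], true⟩,
    ⟨![2, 1, 1], [(0, {0, 2}), (0, {1}), (1, {0, 1, 2}), (2, {1, 2})], true⟩,
    ⟨![2, 1, 1], [(0, {0, 1, 2}), (0, {2}), (1, {0, 1}), (2, {1, 2})], true⟩,
    ⟨![2, 1, 1], [(0, {0, 1, 2}), (0, {2}), (1, {1}), (2, {0, 1, 2})], true⟩,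
    ⟨![2, 1, 1], [(0, {0, 1, 2}), (0, {0, 1}), (1, {1, 2}), (2, {2})], true⟩,
    ⟨![2, 1, 1], [(0, {0, 1, 2}), (0, {0, 1, 2}), (1, ∅), (2, {1, 2})], false⟩,
    ⟨![2, 1, 1], [(0, {0, 1, 2}), (0, {0, 1, 2}), (1, {1}), (2, {2})], true⟩,
    ⟨![3, 1, 1], [(0, {0, 1, 2}), (0, {0, 1, 2}), (0, ∅), (1, {1, 2}), (2, {1, 2})], false⟩,
    ⟨![3, 1, 1], [(0, {0, 1, 2}), (0, {0, 1, 2}), (0, {1}), (1, {1, 2}), (2, {2})], true⟩,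
    ⟨![2, 2, 1], [(0, ∅), (0, {0, 2}), (1, {0, 1, 2}), (1, {0, 1, 2}), (2, {1, 2})], false⟩,
    ⟨![2, 2, 1], [(0, ∅), (0, {0, 1, 2}), (1, {0, 1, 2}), (1, {1, 2}), (2, {0, 2})], false⟩,
    ⟨![2, 2, 1], [(0, ∅), (0, {0, 1, 2}), (1, {0, 1, 2}), (1, {0, 1, 2}), (2, {2})], false⟩,
    ⟨![2, 2, 1], [(0, {0}), (0, {0, 1, 2}), (1, {0, 1, 2}), (1, {1, 2}), (2, {2})], true⟩,
    ⟨![2, 2, 1], [(0, {0, 2}), (0, {0, 2}), (1, {0, 1, 2}), (1, {1}), (2, {1, 2})], true⟩,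
    ⟨![3, 2, 1], [(0, {0, 1, 2}), (0, {0, 1, 2}), (0, ∅), (1, {0, 1, 2}), (1, {1, 2}), (2, {2})], false⟩,
    ⟨![3, 2, 1], [(0, {0, 1, 2}), (0, {0, 1, 2}), (0, ∅), (1, {1, 2}), (1, {1, 2}), (2, {0, 2})], false⟩,
    ⟨![3, 2, 1], [(0, {0, 1, 2}), (0, {0, 1, 2}), (0, {0}), (1, {1, 2}), (1, {1, 2}), (2, {2})], true⟩,
    ⟨![3, 2, 1], [(0, {0, 1, 2}), (0, {0, 1, 2}), (0, {0, 1, 2}), (1, {1, 2}), (1, ∅), (2, {2})], false⟩,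
    ⟨![4, 2, 1], [(0, {0, 1, 2}), (0, {0, 1, 2}), (0, {0, 1, 2}), (0, ∅), (1, {1, 2}), (1, {1, 2}), (2, {2})], false⟩]

/-! ### Entropy of finite random variables -/

section Entropy

variable {Ω α β γ : Type*} [Fintype Ω]

/-! Order the users of an extended network by a function `pos` and remove their sources and
destinations in that order. With the cuts `CutSequence.ofPos`, the GCS expression becomes a sum of
layers: the entropy of what the users at position `l` receive, given all that earlier users send and
receive. By the chain rule the entropy of all messages is at most this sum plus the equivocations
`H(W_v | Y_v)`. Each destination hears exactly one copy of each user, so it sees a replica of the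
original channel with independent inputs. Its error probability is therefore at most that of the
original code, and Fano's inequality makes the equivocations `o(n)`. This is
`sum_rate_le_gcs_ofHear`.

An earlier user contributes its message and its output to the conditioning, hence, by recoverability
of the interference, all three signals that it hears. If for each `j ∈ T` some earlier user hears
the same copy of `j` as `v` does, then `v` costs at most `∑ t, H(Y_i[t] | V_T[t])`
(`gcs_ofHear_le`). Proving a bound is thus a finite design problem: find a network and an order in
which the side information of every term has been heard before. A `Schedule` records such a design,
and `decide` verifies it. For a direct bound one network suffices. For a limit bound, `k` identical
blocks are chained, each able to reveal signals of the next one. One extra copy of each user starts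
the chain, at the cost `H(Y_1) + H(Y_2) + H(Y_3)` per time step, independent of `k`. Permuting the
users merely relabels the schedule.

For (B), the entropies averaged over time lie in a compact set of time-sharing vectors. One limit
point of them serves all bounds and all `k` at once; letting `k → ∞` removes the extra copies, and a
second use of compactness passes to the closure. -/

theorem probOf_setOf (p : Ω → ℝ) (P : Ω → Prop) [DecidablePred P] :
    probOf p {ω | P ω} = ∑ ω, if P ω then p ω else 0 := by
  classical
  refine Finset.sum_congr rfl fun ω _ => ?_
  rw [Set.indicator_apply]
  by_cases h : P ω <;> simp [h]

theorem probOf_nonneg {p : Ω → ℝ} (hp : ∀ ω, 0 ≤ p ω) (s : Set Ω) : 0 ≤ probOf p s :=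
  Finset.sum_nonneg fun ω _ => Set.indicator_nonneg (fun ω _ => hp ω) ω

theorem probOf_mono {p : Ω → ℝ} (hp : ∀ ω, 0 ≤ p ω) {s t : Set Ω} (h : s ⊆ t) :
    probOf p s ≤ probOf p t :=
  Finset.sum_le_sum fun ω _ => Set.indicator_le_indicator_of_subset h hp ω

theorem probOf_univ (p : Ω → ℝ) : probOf p Set.univ = ∑ ω, p ω := by
  simp [probOf]

theorem probOf_pos {p : Ω → ℝ} (hp : ∀ ω, 0 ≤ p ω) {s : Set Ω} {ω : Ω} (hω : 0 < p ω)
    (h : ω ∈ s) : 0 < probOf p s := by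
  refine Finset.sum_pos' (fun ω _ => Set.indicator_nonneg (fun ω _ => hp ω) ω)
    ⟨ω, Finset.mem_univ _, ?_⟩
  rwa [Set.indicator_of_mem h]

/-- Probability that `A` takes the value that it takes at `ω`. -/
noncomputable def fiberProb (p : Ω → ℝ) (A : Ω → α) (ω : Ω) : ℝ :=
  probOf p {ω' | A ω' = A ω}

/-- The entropy `H(A)` in bits. -/
noncomputable def entropy (p : Ω → ℝ) (A : Ω → α) : ℝ :=
  -∑ ω, p ω * Real.logb 2 (fiberProb p A ω)

theorem fiberProb_congr (p : Ω → ℝ) {A : Ω → α} {ω ω' : Ω} (h : A ω = A ω') :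
    fiberProb p A ω = fiberProb p A ω' := by
  simp [fiberProb, h]

theorem fiberProb_nonneg {p : Ω → ℝ} (hp : ∀ ω, 0 ≤ p ω) (A : Ω → α) (ω : Ω) :
    0 ≤ fiberProb p A ω := probOf_nonneg hp _

theorem fiberProb_pos {p : Ω → ℝ} (hp : ∀ ω, 0 ≤ p ω) (A : Ω → α) {ω : Ω} (hω : 0 < p ω) :
    0 < fiberProb p A ω := probOf_pos hp hω rfl

/-- Entropy depends only on the partition of `Ω` into fibres. Variables with different codomains can
therefore be exchanged without exhibiting a bijection. -/
theorem entropy_congr (p : Ω → ℝ) {A : Ω → α} {B : Ω → β}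
    (h : ∀ ω ω', A ω = A ω' ↔ B ω = B ω') : entropy p A = entropy p B := by
  simp [entropy, fiberProb, h]

theorem entropy_mono {p : Ω → ℝ} (hp : ∀ ω, 0 ≤ p ω) {A : Ω → α} {B : Ω → β}
    (h : ∀ ω ω', A ω = A ω' → B ω = B ω') : entropy p B ≤ entropy p A := by
  refine neg_le_neg (Finset.sum_le_sum fun ω _ => ?_)
  rcases (hp ω).eq_or_lt with h0 | h0
  · simp [← h0]
  · exact mul_le_mul_of_nonneg_left (Real.logb_le_logb_of_le one_lt_two (fiberProb_pos hp A h0)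
      (probOf_mono hp fun ω' => h ω' ω)) (hp ω)

open Classical in
theorem sum_probOf_mul [Fintype α] (p : Ω → ℝ) (A : Ω → α) (F : α → ℝ) :
    ∑ a, probOf p {ω | A ω = a} * F a = ∑ ω, p ω * F (A ω) := by
  simp only [probOf_setOf, Finset.sum_mul, ite_mul, zero_mul]
  rw [Finset.sum_comm]
  simp

theorem condEntropy_eq [Fintype α] [Fintype β] {p : Ω → ℝ} (hp : ∀ ω, 0 ≤ p ω) (A : Ω → α)
    (B : Ω → β) : condEntropy p A B = entropy p (fun ω => (A ω, B ω)) - entropy p B := by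
  have h := sum_probOf_mul p (fun ω => (A ω, B ω)) fun x =>
    Real.logb 2 (probOf p {ω | A ω = x.1 ∧ B ω = x.2} / probOf p {ω | B ω = x.2})
  rw [Fintype.sum_prod_type] at h
  simp only [Prod.mk.injEq] at h
  rw [condEntropy, h, entropy, entropy, neg_sub_neg, ← Finset.sum_sub_distrib,
    ← Finset.sum_neg_distrib]
  refine Finset.sum_congr rfl fun ω _ => ?_
  rcases (hp ω).eq_or_lt with h0 | h0
  · simp [← h0]
  · have h1 := (fiberProb_pos hp (fun ω => (A ω, B ω)) h0).ne'
    have h2 := (fiberProb_pos hp B h0).ne'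
    simp only [fiberProb, Prod.mk.injEq] at h1 h2 ⊢
    rw [Real.logb_div h1 h2]
    ring

/-- Gibbs' inequality. -/
theorem sum_mul_logb_nonpos {p f : Ω → ℝ} (hp : ∀ ω, 0 ≤ p ω) (hf : ∀ ω, 0 < p ω → 0 < f ω)
    (h : ∑ ω, p ω * f ω ≤ ∑ ω, p ω) : ∑ ω, p ω * Real.logb 2 (f ω) ≤ 0 := by
  have h2 : 0 < Real.log 2 := Real.log_pos one_lt_two
  have key : ∑ ω, p ω * Real.log (f ω) ≤ ∑ ω, p ω * (f ω - 1) := by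
    refine Finset.sum_le_sum fun ω _ => ?_
    rcases (hp ω).eq_or_lt with h0 | h0
    · simp [← h0]
    · exact mul_le_mul_of_nonneg_left (Real.log_le_sub_one_of_pos (hf ω h0)) (hp ω)
  simp only [mul_sub, mul_one, Finset.sum_sub_distrib] at key
  have : ∑ ω, p ω * Real.logb 2 (f ω) = (∑ ω, p ω * Real.log (f ω)) / Real.log 2 := by
    simp only [Real.logb, Finset.sum_div, mul_div_assoc]
  rw [this]
  exact div_nonpos_of_nonpos_of_nonneg (by linarith) h2.le

/-- The sum is 1 when the event `A = a` has nonzero probability; otherwise it is 0, by the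
convention `x / 0 = 0`. -/
theorem sum_div_fiberProb_le_one [DecidableEq α] (p : Ω → ℝ) (A : Ω → α) (a : α) :
    ∑ ω, (if A ω = a then p ω / fiberProb p A ω else 0) ≤ 1 := by
  have : ∀ ω, (if A ω = a then p ω / fiberProb p A ω else 0) =
      (if A ω = a then p ω else 0) / probOf p {ω | A ω = a} := by
    intro ω
    split_ifs with h
    · rw [fiberProb, h]
    · simp
  simp only [this, ← Finset.sum_div]
  rw [probOf_setOf]
  exact div_self_le_one _

open Classical in
theorem fiberProb_eq_sum (p : Ω → ℝ) (A : Ω → α) (ω : Ω) :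
    fiberProb p A ω = ∑ ω', if A ω' = A ω then p ω' else 0 := by
  simp [fiberProb, probOf_setOf]

-- The normalisation needed to apply Gibbs' inequality to submodularity. Expanding the two
-- numerators draws `ω'` and `ω''` with the same value of `C`; they supply the values of `A` and
-- `B`, and summing over the `ω` that carry this triple leaves a factor of at most 1.
open Classical in
theorem sum_fiberProb_ratio_le {p : Ω → ℝ} (hp : ∀ ω, 0 ≤ p ω) (A : Ω → α) (B : Ω → β)
    (C : Ω → γ) :
    ∑ ω, p ω * (fiberProb p (fun ω => (A ω, C ω)) ω * fiberProb p (fun ω => (B ω, C ω)) ω /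
      (fiberProb p (fun ω => (A ω, B ω, C ω)) ω * fiberProb p C ω)) ≤ ∑ ω, p ω := by
  set D := fun ω => (A ω, B ω, C ω) with hD
  have expand : ∀ ω, p ω * (fiberProb p (fun ω => (A ω, C ω)) ω *
      fiberProb p (fun ω => (B ω, C ω)) ω / (fiberProb p D ω * fiberProb p C ω)) =
      ∑ ω', ∑ ω'', (if C ω'' = C ω' then p ω' * p ω'' / fiberProb p C ω' else 0) *
        (if D ω = (A ω', B ω'', C ω') then p ω / fiberProb p D ω else 0) := by
    intro ω
    rw [fiberProb_eq_sum p (fun ω => (A ω, C ω)), fiberProb_eq_sum p (fun ω => (B ω, C ω)),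
      Finset.sum_mul_sum, Finset.sum_div, Finset.mul_sum]
    refine Finset.sum_congr rfl fun ω' _ => ?_
    rw [Finset.sum_div, Finset.mul_sum]
    refine Finset.sum_congr rfl fun ω'' _ => ?_
    simp only [hD, Prod.mk.injEq]
    by_cases h1 : C ω' = C ω
    · have hc := fiberProb_congr p h1
      by_cases h2 : C ω'' = C ω
      · by_cases h3 : A ω' = A ω
        · by_cases h4 : B ω'' = B ω
          · simp only [h1, h2, h3, h4, hc, and_self, if_true]
            ring
          · simp [h4, Ne.symm h4]
        · simp [h3, Ne.symm h3]
      · simp [h1, h2]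
    · simp [h1, Ne.symm h1]
  simp only [expand]
  rw [Finset.sum_comm]
  refine Finset.sum_le_sum fun ω' _ => ?_
  rw [Finset.sum_comm]
  simp only [← Finset.mul_sum]
  calc _ ≤ ∑ ω'', (if C ω'' = C ω' then p ω' * p ω'' / fiberProb p C ω' else 0) * 1 := by
        refine Finset.sum_le_sum fun ω'' _ => mul_le_mul_of_nonneg_left
          (sum_div_fiberProb_le_one p D _) ?_
        split_ifs
        · exact div_nonneg (mul_nonneg (hp _) (hp _)) (fiberProb_nonneg hp _ _)
        · exact le_rfl
    _ = p ω' * (fiberProb p C ω' / fiberProb p C ω') := by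
        rw [← mul_div_assoc, fiberProb_eq_sum p C, Finset.mul_sum, Finset.sum_div]
        refine Finset.sum_congr rfl fun ω'' _ => ?_
        split_ifs <;> simp
    _ ≤ p ω' := mul_le_of_le_one_right (hp _) (div_self_le_one _)

theorem entropy_submodular {p : Ω → ℝ} (hp : ∀ ω, 0 ≤ p ω) (A : Ω → α) (B : Ω → β)
    (C : Ω → γ) :
    entropy p (fun ω => (A ω, B ω, C ω)) + entropy p C ≤
      entropy p (fun ω => (A ω, C ω)) + entropy p (fun ω => (B ω, C ω)) := by
  have h := sum_mul_logb_nonpos hp (f := fun ω =>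
    fiberProb p (fun ω => (A ω, C ω)) ω * fiberProb p (fun ω => (B ω, C ω)) ω /
      (fiberProb p (fun ω => (A ω, B ω, C ω)) ω * fiberProb p C ω))
    (fun ω h0 => div_pos (mul_pos (fiberProb_pos hp _ h0) (fiberProb_pos hp _ h0))
      (mul_pos (fiberProb_pos hp _ h0) (fiberProb_pos hp _ h0)))
    (sum_fiberProb_ratio_le hp A B C)
  have e : ∀ ω, p ω * Real.logb 2 (fiberProb p (fun ω => (A ω, C ω)) ω *
      fiberProb p (fun ω => (B ω, C ω)) ω /
      (fiberProb p (fun ω => (A ω, B ω, C ω)) ω * fiberProb p C ω)) =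
      p ω * Real.logb 2 (fiberProb p (fun ω => (A ω, C ω)) ω) +
      p ω * Real.logb 2 (fiberProb p (fun ω => (B ω, C ω)) ω) -
      (p ω * Real.logb 2 (fiberProb p (fun ω => (A ω, B ω, C ω)) ω) +
      p ω * Real.logb 2 (fiberProb p C ω)) := by
    intro ω
    rcases (hp ω).eq_or_lt with h0 | h0
    · simp [← h0]
    · have h1 := (fiberProb_pos hp (fun ω => (A ω, C ω)) h0).ne'
      have h2 := (fiberProb_pos hp (fun ω => (B ω, C ω)) h0).ne'
      have h3 := (fiberProb_pos hp (fun ω => (A ω, B ω, C ω)) h0).ne'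
      have h4 := (fiberProb_pos hp C h0).ne'
      rw [Real.logb_div (mul_ne_zero h1 h2) (mul_ne_zero h3 h4), Real.logb_mul h1 h2,
        Real.logb_mul h3 h4]
      ring
  simp only [e, Finset.sum_sub_distrib, Finset.sum_add_distrib] at h
  simp only [entropy]
  linarith

/-- `H(A | B)` as a difference of entropies. -/
noncomputable def entropyGiven (p : Ω → ℝ) (A : Ω → α) (B : Ω → β) : ℝ :=
  entropy p (fun ω => (A ω, B ω)) - entropy p B

/-- Conditioning on more reduces entropy. -/
theorem entropyGiven_le_of_determines {p : Ω → ℝ} (hp : ∀ ω, 0 ≤ p ω) (A : Ω → α) {B : Ω → β}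
    {C : Ω → γ} (h : ∀ ω ω', B ω = B ω' → C ω = C ω') :
    entropyGiven p A B ≤ entropyGiven p A C := by
  have h1 := entropy_submodular hp A B C
  have h2 : entropy p (fun ω => (A ω, B ω, C ω)) = entropy p (fun ω => (A ω, B ω)) :=
    entropy_congr p fun ω ω' => by
      simp only [Prod.mk.injEq]
      have := h ω ω'
      tauto
  have h3 : entropy p (fun ω => (B ω, C ω)) = entropy p B :=
    entropy_congr p fun ω ω' => by
      simp only [Prod.mk.injEq]
      have := h ω ω'
      tauto
  simp only [entropyGiven]
  linarith

theorem entropyGiven_nonneg {p : Ω → ℝ} (hp : ∀ ω, 0 ≤ p ω) (A : Ω → α) (B : Ω → β) :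
    0 ≤ entropyGiven p A B :=
  sub_nonneg.2 (entropy_mono hp fun _ _ h => (Prod.mk.inj h).2)

/-- Subadditivity of conditional entropy for a finite family of variables. -/
theorem entropyGiven_pi_le {ι : Type*} {φ : ι → Type*} {p : Ω → ℝ} (hp : ∀ ω, 0 ≤ p ω)
    (A : ∀ i, Ω → φ i) (B : Ω → β) (s : Finset ι) :
    entropyGiven p (fun ω (i : s) => A i ω) B ≤ ∑ i ∈ s, entropyGiven p (A i) B := by
  classical
  induction s using Finset.induction_on with
  | empty =>
    rw [Finset.sum_empty, entropyGiven, sub_nonpos]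
    refine (entropy_congr p fun ω ω' => ?_).le
    simp [funext_iff]
  | insert a s ha ih =>
    rw [Finset.sum_insert ha]
    have h := entropy_submodular hp (A a) (fun ω (i : s) => A i ω) B
    have e : entropy p (fun ω => ((fun i : (insert a s : Finset ι) => A i ω), B ω)) =
        entropy p (fun ω => (A a ω, (fun i : s => A i ω), B ω)) :=
      entropy_congr p fun ω ω' => by
        simp [funext_iff, and_assoc]
    simp only [entropyGiven] at ih ⊢
    linarith

/-- A change of variables. -/
theorem entropy_comp {Ω' : Type*} [Fintype Ω'] (p : Ω → ℝ) (φ : Ω → Ω') (A : Ω' → α) :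
    entropy p (fun ω => A (φ ω)) = entropy (fun x => probOf p {ω | φ ω = x}) A := by
  classical
  have h : ∀ ω, fiberProb p (fun ω => A (φ ω)) ω =
      fiberProb (fun x => probOf p {ω | φ ω = x}) A (φ ω) := by
    intro ω
    rw [fiberProb_eq_sum, fiberProb_eq_sum]
    have := sum_probOf_mul p φ fun x => if A x = A (φ ω) then 1 else 0
    simpa using this.symm
  rw [entropy, entropy, sum_probOf_mul p φ fun x =>
    Real.logb 2 (fiberProb (fun x => probOf p {ω | φ ω = x}) A x)]
  simp [h]

theorem entropy_eq_sum_negMulLog [Fintype α] (p : Ω → ℝ) (A : Ω → α) :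
    entropy p A = (∑ a, Real.negMulLog (probOf p {ω | A ω = a})) / Real.log 2 := by
  have := sum_probOf_mul p A fun a => Real.logb 2 (probOf p {ω | A ω = a})
  rw [entropy]
  simp only [fiberProb]
  rw [← this, ← Finset.sum_neg_distrib, Finset.sum_div]
  refine Finset.sum_congr rfl fun a _ => ?_
  rw [Real.negMulLog, Real.logb]
  ring

open Classical in
/-- Fano's inequality. -/
theorem entropyGiven_le_fano {p : Ω → ℝ} (hp : ∀ ω, 0 ≤ p ω) (hp1 : ∑ ω, p ω = 1) [Fintype α]
    [Nonempty α] (W : Ω → α) (B : Ω → β) (d : β → α) :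
    entropyGiven p W B ≤
      1 + probOf p {ω | d (B ω) ≠ W ω} * Real.logb 2 (Fintype.card α) := by
  set M : ℝ := (Fintype.card α : ℝ) with hM
  have hM0 : 0 < M := by
    rw [hM]
    exact_mod_cast Fintype.card_pos
  -- Gibbs' inequality is applied to a guess of `W` from `B`: half of the mass on the decoded value,
  -- half spread uniformly. The bound `q'` keeps only the dominant part, so a correct decision costs
  -- 1 bit and a wrong one `1 + log₂ M` bits.
  let q : α → β → ℝ := fun w b => (if d b = w then 2⁻¹ else 0) + (2 * M)⁻¹
  let q' : Ω → ℝ := fun ω => if d (B ω) = W ω then 2⁻¹ else (2 * M)⁻¹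
  have hq'0 : ∀ ω, 0 < q' ω := by
    intro ω
    simp only [q']
    split_ifs <;> positivity
  have hq0 : ∀ w b, 0 ≤ q w b := by
    intro w b
    simp only [q]
    split_ifs <;> positivity
  have hq1 : ∀ b, ∑ w, q w b = 1 := by
    intro b
    simp only [q, Finset.sum_add_distrib, Finset.sum_const, Finset.card_univ, nsmul_eq_mul, ← hM,
      Finset.sum_ite_eq, Finset.mem_univ, if_true]
    field_simp
    norm_num
  have hqq : ∀ ω, q' ω ≤ q (W ω) (B ω) := by
    intro ω
    simp only [q, q']
    split_ifs
    · exact le_add_of_nonneg_right (by positivity)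
    · simp
  set D := fun ω => (W ω, B ω) with hD
  have hsum : ∑ ω, p ω * (fiberProb p B ω * q' ω / fiberProb p D ω) ≤ ∑ ω, p ω := by
    calc ∑ ω, p ω * (fiberProb p B ω * q' ω / fiberProb p D ω)
        ≤ ∑ ω, p ω * (fiberProb p B ω * q (W ω) (B ω) / fiberProb p D ω) := by
          refine Finset.sum_le_sum fun ω _ => ?_
          have := fiberProb_nonneg hp B ω
          have := fiberProb_nonneg hp D ω
          have := hp ω
          have := hqq ω
          gcongr
      _ = ∑ ω, ∑ ω', ∑ w, p ω' * q w (B ω') *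
            (if D ω = (w, B ω') then p ω / fiberProb p D ω else 0) := by
          refine Finset.sum_congr rfl fun ω _ => ?_
          rw [fiberProb_eq_sum p B, Finset.sum_mul, Finset.sum_div, Finset.mul_sum]
          refine Finset.sum_congr rfl fun ω' _ => ?_
          simp only [hD, Prod.mk.injEq]
          by_cases h : B ω' = B ω
          · simp only [h, and_true, if_true, mul_ite, mul_zero, Finset.sum_ite_eq, Finset.mem_univ]
            ring
          · simp [h, Ne.symm h]
      _ = ∑ ω', ∑ w, p ω' * q w (B ω') *
            ∑ ω, (if D ω = (w, B ω') then p ω / fiberProb p D ω else 0) := by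
          rw [Finset.sum_comm]
          refine Finset.sum_congr rfl fun ω' _ => ?_
          rw [Finset.sum_comm]
          simp only [Finset.mul_sum]
      _ ≤ ∑ ω', ∑ w, p ω' * q w (B ω') * 1 := by
          refine Finset.sum_le_sum fun ω' _ => Finset.sum_le_sum fun w _ =>
            mul_le_mul_of_nonneg_left (sum_div_fiberProb_le_one p D _) (mul_nonneg (hp _) (hq0 _ _))
      _ = ∑ ω, p ω := by
          simp only [mul_one, ← Finset.mul_sum, hq1]
  have h := sum_mul_logb_nonpos hp (fun ω h0 => div_pos (mul_pos (fiberProb_pos hp B h0) (hq'0 ω))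
    (fiberProb_pos hp D h0)) hsum
  have e : ∀ ω, p ω * Real.logb 2 (fiberProb p B ω * q' ω / fiberProb p D ω) =
      p ω * Real.logb 2 (fiberProb p B ω) - p ω * Real.logb 2 (fiberProb p D ω) - p ω -
        (if d (B ω) ≠ W ω then p ω else 0) * Real.logb 2 M := by
    intro ω
    rcases (hp ω).eq_or_lt with h0 | h0
    · simp [← h0]
    · rw [Real.logb_div (mul_pos (fiberProb_pos hp B h0) (hq'0 ω)).ne' (fiberProb_pos hp D h0).ne',
        Real.logb_mul (fiberProb_pos hp B h0).ne' (hq'0 ω).ne']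
      have : Real.logb 2 2 = 1 := Real.logb_self_eq_one one_lt_two
      by_cases hd : d (B ω) = W ω
      · simp only [q', hd, if_true, Real.logb_inv, this, ne_eq, not_true, if_false]
        ring
      · simp only [q', hd, if_false, Real.logb_inv, Real.logb_mul two_ne_zero hM0.ne', this, ne_eq,
          not_false_iff, if_true]
        ring
  simp only [e, Finset.sum_sub_distrib, ← Finset.sum_mul, hp1] at h
  have : probOf p {ω | d (B ω) ≠ W ω} = ∑ ω, if d (B ω) ≠ W ω then p ω else 0 :=
    probOf_setOf p _
  rw [this, entropyGiven, entropy, entropy]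
  linarith

end Entropy

/-! ### Cut-set decompositions of entropy -/

section CutSet

variable {Ω ι : Type*} [Fintype Ω] [Fintype ι] {α β : ι → Type*} {γ : Type*}

theorem entropyGiven_congr {α β α' β' : Type*} (p : Ω → ℝ) {A : Ω → α} {B : Ω → β} {A' : Ω → α'}
    {B' : Ω → β'} (hA : ∀ ω ω', A ω = A ω' ↔ A' ω = A' ω')
    (hB : ∀ ω ω', B ω = B ω' ↔ B' ω = B' ω') : entropyGiven p A B = entropyGiven p A' B' := by
  rw [entropyGiven, entropyGiven, entropy_congr p hB,
    entropy_congr p (B := fun ω => (A' ω, B' ω)) fun ω ω' => by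
      simp only [Prod.mk.injEq, hA, hB]]

theorem entropyGiven_fintype_pi_le {p : Ω → ℝ} (hp : ∀ ω, 0 ≤ p ω) (A : Ω → ∀ i, α i)
    (B : Ω → γ) : entropyGiven p A B ≤ ∑ i, entropyGiven p (fun ω => A ω i) B := by
  refine le_trans (le_of_eq ?_) (entropyGiven_pi_le hp (fun i ω => A ω i) B Finset.univ)
  exact entropyGiven_congr p (fun ω ω' => by simp [funext_iff]) fun _ _ => Iff.rfl

/-- Everything that the users before position `l` send and receive. -/
def past (W : ∀ v, Ω → α v) (Y : ∀ v, Ω → β v) (pos : ι → ℕ) (l : ℕ) (ω : Ω)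
    (v : {v // pos v < l}) : α v.1 × β v.1 :=
  (W v ω, Y v ω)

/-- Entropy of what the users at position `l` receive, given the past. -/
noncomputable def layerEntropy (p : Ω → ℝ) (W : ∀ v, Ω → α v) (Y : ∀ v, Ω → β v) (pos : ι → ℕ)
    (l : ℕ) : ℝ :=
  entropyGiven p (fun ω (v : (Finset.univ.filter (pos · = l) : Finset ι)) => Y v ω)
    (past W Y pos l)

variable {p : Ω → ℝ} (hp : ∀ ω, 0 ≤ p ω) (W : ∀ v, Ω → α v) (Y : ∀ v, Ω → β v) {pos : ι → ℕ}
  {L : ℕ} (hL : ∀ v, pos v < L)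

include hp in
theorem sum_layerEntropy_nonneg :
    0 ≤ ∑ l ∈ Finset.range L, layerEntropy p W Y pos l :=
  Finset.sum_nonneg fun _ _ => entropyGiven_nonneg hp _ _

include hL in
theorem sum_range_sum_filter (f : ι → ℝ) :
    ∑ l ∈ Finset.range L, ∑ v with pos v = l, f v = ∑ v, f v :=
  Finset.sum_fiberwise_of_maps_to (fun v _ => Finset.mem_range.2 (hL v)) f

include hp hL in
theorem sum_layerEntropy_le :
    ∑ l ∈ Finset.range L, layerEntropy p W Y pos l ≤
      ∑ v, entropyGiven p (Y v) (past W Y pos (pos v)) := by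
  rw [← sum_range_sum_filter hL]
  refine Finset.sum_le_sum fun l _ => ?_
  refine (entropyGiven_pi_le hp Y (past W Y pos l) _).trans (Finset.sum_le_sum fun v hv => ?_)
  rw [(Finset.mem_filter.1 hv).2]

-- Chain rule for one layer: first the outputs given the past, then the messages given those outputs
-- and the past. In the second part each message keeps only its own output as conditioning.
include hp in
theorem entropy_past_succ_sub_le (l : ℕ) :
    entropy p (past W Y pos (l + 1)) - entropy p (past W Y pos l) ≤
      layerEntropy p W Y pos l + ∑ v with pos v = l, entropyGiven p (W v) (Y v) := by
  have h1 := entropyGiven_pi_le hp W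
    (fun ω => ((fun v : (Finset.univ.filter (pos · = l) : Finset ι) => Y v ω),
      past W Y pos l ω)) (Finset.univ.filter (pos · = l))
  have h2 : entropy p (past W Y pos (l + 1)) = entropy p (fun ω =>
      ((fun v : (Finset.univ.filter (pos · = l) : Finset ι) => W v ω),
        (fun v : (Finset.univ.filter (pos · = l) : Finset ι) => Y v ω), past W Y pos l ω)) := by
    refine entropy_congr p fun ω ω' => ?_
    simp only [past, funext_iff, Subtype.forall, Prod.mk.injEq, Finset.mem_filter,
      Finset.mem_univ, true_and, Nat.lt_succ_iff_lt_or_eq]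
    constructor
    · exact fun h => ⟨fun v hv => (h v (Or.inr hv)).1, fun v hv => (h v (Or.inr hv)).2,
        fun v hv => h v (Or.inl hv)⟩
    · rintro ⟨h1, h2, h3⟩ v (hv | hv)
      exacts [h3 v hv, ⟨h1 v hv, h2 v hv⟩]
  have h3 : ∀ v ∈ Finset.univ.filter (pos · = l), entropyGiven p (W v)
      (fun ω => ((fun v : (Finset.univ.filter (pos · = l) : Finset ι) => Y v ω),
        past W Y pos l ω)) ≤ entropyGiven p (W v) (Y v) := fun v hv =>
    entropyGiven_le_of_determines hp _ fun ω ω' h => congrFun (Prod.mk.inj h).1 ⟨v, hv⟩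
  have h4 := Finset.sum_le_sum h3
  rw [h2]
  simp only [entropyGiven, layerEntropy] at h1 h4 ⊢
  linarith

include hp hL in
/-- The generalized cut-set bound, with the equivocations of the messages as error terms. -/
theorem entropy_le_sum_layerEntropy (hp1 : ∑ ω, p ω = 1) :
    entropy p (fun ω v => W v ω) ≤
      ∑ l ∈ Finset.range L, layerEntropy p W Y pos l + ∑ v, entropyGiven p (W v) (Y v) := by
  have h0 : entropy p (past W Y pos 0) = 0 := by
    have : ∀ ω, fiberProb p (past W Y pos 0) ω = 1 := by
      intro ω
      rw [← hp1, ← probOf_univ, fiberProb]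
      congr 1
      ext ω'
      simp [funext_iff]
    simp [entropy, this]
  have h1 : entropy p (fun ω v => W v ω) ≤ entropy p (past W Y pos L) :=
    entropy_mono hp fun ω ω' h => funext fun v => congrArg Prod.fst (congrFun h ⟨v, hL v⟩)
  have h2 := Finset.sum_le_sum fun l (_ : l ∈ Finset.range L) =>
    entropy_past_succ_sub_le hp W Y (pos := pos) l
  rw [Finset.sum_range_sub fun l => entropy p (past W Y pos l), Finset.sum_add_distrib, sum_range_sum_filter hL, h0] at h2
  linarith

end CutSet

/-! ### Uniform distributions on products -/

section Uniform

theorem uniformLaw_nonneg (Ω : Type*) [Fintype Ω] (ω : Ω) : 0 ≤ uniformLaw Ω ω := by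
  simp [uniformLaw]

theorem sum_uniformLaw (Ω : Type*) [Fintype Ω] [Nonempty Ω] : ∑ ω, uniformLaw Ω ω = 1 := by
  simp [uniformLaw]

theorem entropy_uniformLaw {Ω α : Type*} [Fintype Ω] [Nonempty Ω] {A : Ω → α}
    (hA : Function.Injective A) :
    entropy (uniformLaw Ω) A = Real.logb 2 (Fintype.card Ω) := by
  classical
  have : ∀ ω, fiberProb (uniformLaw Ω) A ω = (Fintype.card Ω : ℝ)⁻¹ := by
    intro ω
    simp [fiberProb_eq_sum, hA.eq_iff, uniformLaw]
  simp only [entropy, this, uniformLaw, Finset.sum_const, Finset.card_univ, nsmul_eq_mul,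
    Real.logb_inv]
  field_simp

open Classical in
/-- Under the uniform distribution the messages of one copy of each user are independent and
uniform. -/
theorem probOf_uniformLaw_copies {m : Fin 3 → ℕ} {M : Fin 3 → Type*} [∀ i, Fintype (M i)]
    [∀ i, Nonempty (M i)] (c : ∀ j, Fin (m j)) (S : ∀ j, Set (M j)) :
    probOf (uniformLaw (∀ v : ExtUser m, M v.1)) {w | ∀ j, w ⟨j, c j⟩ ∈ S j} =
      ∏ j, probOf (uniformLaw (M j)) (S j) := by
  -- The weight of the event is a product over all copies, in which only the selected copies are
  -- constrained; its sum is then a product of sums.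
  let f : ∀ v : ExtUser m, M v.1 → ℝ := fun v x =>
    if v.2 = c v.1 → x ∈ S v.1 then (Fintype.card (M v.1) : ℝ)⁻¹ else 0
  have h1 : ∀ w : ∀ v : ExtUser m, M v.1, ∏ v, f v (w v) =
      if ∀ j, w ⟨j, c j⟩ ∈ S j then uniformLaw (∀ v : ExtUser m, M v.1) w else 0 := by
    intro w
    have : (∀ v ∈ (Finset.univ : Finset (ExtUser m)), v.2 = c v.1 → w v ∈ S v.1) ↔
        ∀ j, w ⟨j, c j⟩ ∈ S j := by
      constructor
      · exact fun h j => h ⟨j, c j⟩ (Finset.mem_univ _) rfl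
      · rintro h ⟨j, r⟩ - hr
        obtain rfl : r = c j := hr
        exact h j
    rw [Finset.prod_ite_zero]
    by_cases hw : ∀ j, w ⟨j, c j⟩ ∈ S j
    · rw [if_pos (this.2 hw), if_pos hw]
      simp [uniformLaw, Fintype.card_pi]
    · rw [if_neg (mt this.1 hw), if_neg hw]
  have h2 : ∀ v : ExtUser m, ∑ x, f v x =
      if v.2 = c v.1 then probOf (uniformLaw (M v.1)) (S v.1) else 1 := by
    intro v
    split_ifs with h
    · simp only [f, h, forall_const]
      exact (probOf_setOf (uniformLaw (M v.1)) (· ∈ S v.1)).symm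
    · simp [f, h]
  rw [probOf_setOf]
  simp only [← h1]
  have h3 := Finset.prod_univ_sum (fun _ => Finset.univ) f
  rw [Fintype.piFinset_univ] at h3
  rw [← h3]
  simp only [h2]
  rw [Fintype.prod_sigma]
  simp

theorem probOf_comp {Ω Ω' : Type*} [Fintype Ω] [Fintype Ω'] (p : Ω → ℝ) (φ : Ω → Ω')
    (S : Set Ω') : probOf p {ω | φ ω ∈ S} = probOf (fun x => probOf p {ω | φ ω = x}) S := by
  classical
  have := sum_probOf_mul p φ fun x => if x ∈ S then 1 else 0
  rw [probOf_setOf, ← Set.ofPred_mem_eq (s := S), probOf_setOf]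
  simpa using this.symm

theorem probOf_iUnion_le {Ω ι : Type*} [Fintype Ω] [Fintype ι] {p : Ω → ℝ} (hp : ∀ ω, 0 ≤ p ω)
    (P : ι → Ω → Prop) : probOf p {ω | ∃ i, P i ω} ≤ ∑ i, probOf p {ω | P i ω} := by
  classical
  simp only [probOf_setOf]
  rw [Finset.sum_comm]
  refine Finset.sum_le_sum fun ω _ => ?_
  have h0 : ∀ i, 0 ≤ if P i ω then p ω else 0 := fun i => by split_ifs <;> simp [hp]
  split_ifs with h
  · obtain ⟨i, hi⟩ := h
    have := Finset.single_le_sum (fun i _ => h0 i) (Finset.mem_univ i)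
    rwa [if_pos hi] at this
  · exact Finset.sum_nonneg fun i _ => h0 i

end Uniform

/-! ### Extended networks -/

section Network

theorem numMessages_pos (n : ℕ) (r : ℝ) : 0 < numMessages n r :=
  Nat.ceil_pos.2 (by positivity)

instance (n : ℕ) (r : ℝ) : NeZero (numMessages n r) := ⟨(numMessages_pos n r).ne'⟩

theorem le_logb_numMessages (n : ℕ) (r : ℝ) : n * r ≤ Real.logb 2 (numMessages n r) := by
  rw [Real.le_logb_iff_rpow_le one_lt_two (by exact_mod_cast numMessages_pos n r)]
  exact Nat.le_ceil _

theorem logb_numMessages_le (n : ℕ) {r : ℝ} (hr : 0 ≤ r) :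
    Real.logb 2 (numMessages n r) ≤ n * r + 1 := by
  rw [Real.logb_le_iff_le_rpow one_lt_two (by exact_mod_cast numMessages_pos n r),
    Real.rpow_add_one two_ne_zero]
  have h1 : (1 : ℝ) ≤ 2 ^ ((n : ℝ) * r) := Real.one_le_rpow one_le_two (by positivity)
  have h2 := (Nat.ceil_lt_add_one (a := (2 : ℝ) ^ ((n : ℝ) * r)) (by positivity)).le
  rw [numMessages]
  linarith

variable {m : Fin 3 → ℕ}

/-- The extended network in which copy `v` hears copy `hear v j` of user `j`. -/
def ExtendedNetwork.ofHear (hear : ExtUser m → ∀ j, Fin (m j)) : ExtendedNetwork m where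
  src v j := hear v j

/-- The cut sequence that removes the users in the order given by `pos`. -/
def CutSequence.ofPos (pos : ExtUser m → ℕ) : CutSequence m where
  len := Finset.univ.sup pos + 1
  cut l := Finset.univ.filter (l ≤ Sum.elim (fun v => pos v + 1) pos ·)
  first := by
    ext (v | v) <;> simp
  last := by
    ext (v | v)
    all_goals
      have := Finset.le_sup (f := pos) (Finset.mem_univ v)
      simp
      omega
  nested l _ := by
    rintro (v | v) <;> simp <;> omega
  linked l _ v := by simp

variable {X V Y : Fin 3 → Type*} {n : ℕ} {R : Fin 3 → ℝ} (N : DIC X V Y) (C : Code X Y n R)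
  {hear : ExtUser m → ∀ j, Fin (m j)} (hself : ∀ v, hear v v.1 = v.2)

-- `hear` is defined at the user's own index too, where `hself` makes it point to the copy itself. A
-- copy is then the original channel fed with the triple `hear v`.
include hself in
theorem recv_ofHear (w : ∀ v : ExtUser m, Fin (numMessages n (R v.1))) (v : ExtUser m)
    (t : Fin n) : (ExtendedNetwork.ofHear hear).recv N C w v t =
      N.output (fun j => C.enc j (w ⟨j, hear v j⟩) t) v.1 := by
  obtain ⟨i, r⟩ := v
  have h : hear ⟨i, r⟩ i = r := hself ⟨i, r⟩
  simp only [ExtendedNetwork.recv, ExtendedNetwork.output, DIC.output, ExtendedNetwork.ofHear]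
  rw [h]

/-- Each triple of copies, one per user, has the joint message law of the original channel. Hence
error events and single-letter entropies of a copy can be computed there. -/
theorem map_uniformLaw_copies {M : Fin 3 → Type*} [∀ i, Fintype (M i)] [∀ i, Nonempty (M i)]
    (c : ∀ j, Fin (m j)) :
    (fun x : ∀ j, M j => probOf (uniformLaw (∀ v : ExtUser m, M v.1))
      {w | (fun j => w ⟨j, c j⟩) = x}) = uniformLaw (∀ j, M j) := by
  classical
  ext x
  have := probOf_uniformLaw_copies (M := M) c fun j => {x j}
  simp only [Set.mem_singleton_iff] at this
  simp only [funext_iff, this]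
  have h : ∀ j, probOf (uniformLaw (M j)) {x j} = (Fintype.card (M j) : ℝ)⁻¹ := by
    intro j
    have : ({x j} : Set (M j)) = {y | y = x j} := rfl
    rw [this, probOf_setOf]
    simp [uniformLaw]
  simp [h, uniformLaw, Fintype.card_pi]

theorem map_uniformLaw_inputs (c : ∀ j, Fin (m j)) (t : Fin n) :
    (fun x : ∀ j, X j => probOf (uniformLaw (∀ v : ExtUser m, Fin (numMessages n (R v.1))))
      {w | (fun j => C.enc j (w ⟨j, c j⟩) t) = x}) = fun x => ∏ j, C.inputLaw t j (x j) := by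
  ext x
  have := probOf_uniformLaw_copies (M := fun j => Fin (numMessages n (R j))) c
    fun j => {y | C.enc j y t = x j}
  simp only [Set.mem_ofPred_eq] at this
  simp only [funext_iff, this, Code.inputLaw]

-- The error event of a copy of user `i` is the pullback of the error event of destination `i` in
-- the original channel.
include hself in
theorem probOf_error_copy_le (v : ExtUser m) :
    probOf (uniformLaw (∀ v : ExtUser m, Fin (numMessages n (R v.1))))
      {w | C.dec v.1 ((ExtendedNetwork.ofHear hear).recv N C w v) ≠ w v} ≤ N.errorProb C := by
  have h1 : {w : ∀ v : ExtUser m, Fin (numMessages n (R v.1)) |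
      C.dec v.1 ((ExtendedNetwork.ofHear hear).recv N C w v) ≠ w v} =
      {w | (fun j => w ⟨j, hear v j⟩) ∈ {w' : ∀ j, Fin (numMessages n (R j)) |
        C.dec v.1 (fun t => N.output (fun j => C.enc j (w' j) t) v.1) ≠ w' v.1}} := by
    ext w
    have h2 : (ExtendedNetwork.ofHear hear).recv N C w v =
        fun t => N.output (fun j => C.enc j (w ⟨j, hear v j⟩) t) v.1 :=
      funext fun t => recv_ofHear N C hself w v t
    have h3 : w ⟨v.1, hear v v.1⟩ = w v := by
      obtain ⟨i, r⟩ := v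
      have h : hear ⟨i, r⟩ i = r := hself ⟨i, r⟩
      simp only
      rw [h]
    simp only [Set.mem_ofPred_eq, h2, h3]
  rw [h1, probOf_comp, map_uniformLaw_copies (M := fun j => Fin (numMessages n (R j)))]
  exact probOf_mono (uniformLaw_nonneg _) fun w hw => ⟨v.1, hw⟩

include hself in
theorem errorProb_ofHear_le : (ExtendedNetwork.ofHear hear).errorProb N C ≤
    Fintype.card (ExtUser m) * N.errorProb C := by
  refine (probOf_iUnion_le (uniformLaw_nonneg _) _).trans
    ((Finset.sum_le_sum fun v _ => probOf_error_copy_le N C hself v).trans ?_)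
  simp

theorem inputLaw_nonneg (t : Fin n) (i : Fin 3) (x : X i) : 0 ≤ C.inputLaw t i x :=
  probOf_nonneg (uniformLaw_nonneg _) _

include hself in
/-- The past determines the signals heard by the earlier users. -/
theorem signal_eq_of_past_eq {pos : ExtUser m → ℕ} {l : ℕ}
    {w w' : ∀ v : ExtUser m, Fin (numMessages n (R v.1))}
    (h : past (fun v (w : ∀ v : ExtUser m, Fin (numMessages n (R v.1))) => w v)
      (fun v w => (ExtendedNetwork.ofHear hear).recv N C w v) pos l w =
      past (fun v w => w v) (fun v w => (ExtendedNetwork.ofHear hear).recv N C w v) pos l w')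
    {u : ExtUser m} (hu : pos u < l) (j : Fin 3) (t : Fin n) :
    N.g j (C.enc j (w ⟨j, hear u j⟩) t) = N.g j (C.enc j (w' ⟨j, hear u j⟩) t) := by
  have h1 := congrFun h ⟨u, hu⟩
  simp only [past, Prod.mk.injEq] at h1
  obtain ⟨hw, hy⟩ := h1
  have hy := congrFun hy t
  rw [recv_ofHear N C hself, recv_ofHear N C hself] at hy
  have hw' : w ⟨u.1, hear u u.1⟩ = w' ⟨u.1, hear u u.1⟩ := by
    obtain ⟨i, r⟩ := u
    have h : hear ⟨i, r⟩ i = r := hself ⟨i, r⟩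
    simp only
    rw [h]
    exact hw
  -- A user's own signal follows from its message through the encoder, the other two from its input
  -- and output through `N.recover`.
  by_cases hj : j = u.1
  · subst hj
    rw [hw']
  · have r1 := N.recover u.1 fun j => C.enc j (w ⟨j, hear u j⟩) t
    have r2 := N.recover u.1 fun j => C.enc j (w' ⟨j, hear u j⟩) t
    simp only [DIC.output] at hy
    rw [hy] at r1
    simp only [hw'] at r1
    rw [r1] at r2
    exact congrFun r2 ⟨j, hj⟩

variable [∀ i, Fintype (Y i)]

/-- A destination leaves the cuts one step before its source. Thus the destinations lost between
`cut l` and `cut (l + 1)` are those at position `l`, while the messages and outputs conditioned on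
are both those of the users before `l`. -/
theorem gcs_ofHear (pos : ExtUser m → ℕ) :
    (ExtendedNetwork.ofHear hear).gcs N C (CutSequence.ofPos pos) =
      ∑ l ∈ Finset.range (Finset.univ.sup pos + 1),
        layerEntropy (uniformLaw (∀ v : ExtUser m, Fin (numMessages n (R v.1)))) (fun v w => w v)
          (fun v w => (ExtendedNetwork.ofHear hear).recv N C w v) pos l := by
  refine Finset.sum_congr rfl fun l _ => ?_
  rw [condEntropy_eq (uniformLaw_nonneg _)]
  refine entropyGiven_congr _ (fun w w' => ?_) fun w w' => ?_
  · simp only [funext_iff, CutSequence.ofPos, Subtype.forall, Finset.mem_filter, Finset.mem_univ,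
      true_and, Sum.elim_inr]
    refine forall_congr' fun v => imp_congr_left ?_
    omega
  · simp only [past, funext_iff, CutSequence.ofPos, Subtype.forall, Finset.mem_filter,
      Finset.mem_univ, true_and, Sum.elim_inr, Sum.elim_inl, Prod.mk.injEq, not_le,
      add_lt_add_iff_right, ← forall_and]

theorem gcs_ofHear_nonneg (pos : ExtUser m → ℕ) :
    0 ≤ (ExtendedNetwork.ofHear hear).gcs N C (CutSequence.ofPos pos) := by
  rw [gcs_ofHear]
  exact sum_layerEntropy_nonneg (uniformLaw_nonneg _) _ _

include hself in
/-- The generalized cut-set bound. -/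
theorem sum_rate_le_gcs_ofHear (hR : ∀ i, 0 ≤ R i) (pos : ExtUser m → ℕ) :
    n * ∑ i, (m i : ℝ) * R i ≤
      (ExtendedNetwork.ofHear hear).gcs N C (CutSequence.ofPos pos) +
        ∑ v : ExtUser m, (1 + N.errorProb C * (n * R v.1 + 1)) := by
  have hp := uniformLaw_nonneg (∀ v : ExtUser m, Fin (numMessages n (R v.1)))
  have h1 := entropy_le_sum_layerEntropy hp (fun v w => w v)
    (fun v w => (ExtendedNetwork.ofHear hear).recv N C w v) (fun v =>
      Nat.lt_succ_of_le (Finset.le_sup (f := pos) (Finset.mem_univ v))) (sum_uniformLaw _)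
  rw [entropy_uniformLaw fun w w' h => h, ← gcs_ofHear, Fintype.card_pi, Nat.cast_prod,
    Real.logb_prod _ _ fun v _ => by simp [(numMessages_pos n (R v.1)).ne']] at h1
  have h2 : n * ∑ i, (m i : ℝ) * R i = ∑ v : ExtUser m, n * R v.1 := by
    rw [← Finset.mul_sum, Fintype.sum_sigma]
    simp
  have h3 : ∑ v : ExtUser m, n * R v.1 ≤
      ∑ v : ExtUser m, Real.logb 2 (Fintype.card (Fin (numMessages n (R v.1)))) :=
    Finset.sum_le_sum fun v _ => by
      rw [Fintype.card_fin]
      exact le_logb_numMessages n _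
  have h4 : ∑ v : ExtUser m, entropyGiven
      (uniformLaw (∀ v : ExtUser m, Fin (numMessages n (R v.1)))) (fun w => w v)
      (fun w => (ExtendedNetwork.ofHear hear).recv N C w v) ≤
      ∑ v : ExtUser m, (1 + N.errorProb C * (n * R v.1 + 1)) := by
    refine Finset.sum_le_sum fun v _ => ?_
    refine (entropyGiven_le_fano hp (sum_uniformLaw _) _ _ (C.dec v.1)).trans ?_
    have := mul_le_mul (probOf_error_copy_le N C hself v) (logb_numMessages_le n (hR v.1))
      (Real.logb_nonneg one_lt_two (by exact_mod_cast numMessages_pos n (R v.1)))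
      (probOf_nonneg (uniformLaw_nonneg _) _)
    rw [Fintype.card_fin]
    linarith
  linarith

include hself in
theorem ofHear_asymptotics (pos : ExtUser m → ℕ) (R : Fin 3 → ℝ) (n : ℕ → ℕ)
    (C : ∀ s, Code X Y (n s) R) (hR : ∀ i, 0 ≤ R i) (hn : Tendsto n atTop atTop)
    (hC : Tendsto (fun s => N.errorProb (C s)) atTop (𝓝 0)) :
    Tendsto (fun s => (ExtendedNetwork.ofHear hear).errorProb N (C s)) atTop (𝓝 0) ∧
      ∃ ε : ℕ → ℝ, Tendsto ε atTop (𝓝 0) ∧ ∀ s, (n s : ℝ) * ∑ i, (m i : ℝ) * R i ≤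
        (ExtendedNetwork.ofHear hear).gcs N (C s) (CutSequence.ofPos pos) + n s * ε s := by
  constructor
  · refine squeeze_zero (fun s => probOf_nonneg (uniformLaw_nonneg _) _)
      (fun s => errorProb_ofHear_le N (C s) hself) ?_
    simpa using hC.const_mul (Fintype.card (ExtUser m) : ℝ)
  -- The Fano terms `1 + P_e (n R + 1)` divided by the block length.
  · refine ⟨fun s => ∑ v : ExtUser m, ((n s : ℝ)⁻¹ +
      N.errorProb (C s) * (R v.1 + (n s : ℝ)⁻¹)), ?_, fun s => ?_⟩
    · have hn' : Tendsto (fun s => (n s : ℝ)⁻¹) atTop (𝓝 0) :=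
        tendsto_inv_atTop_zero.comp (tendsto_natCast_atTop_atTop.comp hn)
      have : ∀ v ∈ (Finset.univ : Finset (ExtUser m)), Tendsto (fun s => (n s : ℝ)⁻¹ +
          N.errorProb (C s) * (R v.1 + (n s : ℝ)⁻¹)) atTop (𝓝 0) := by
        intro v _
        simpa using hn'.add (hC.mul (tendsto_const_nhds.add hn'))
      simpa using tendsto_finsetSum _ this
    -- At block length 0 the error term `n * ε` vanishes and only nonnegativity of the GCS
    -- expression remains to be shown.
    · rcases Nat.eq_zero_or_pos (n s) with h0 | h0
      · have := gcs_ofHear_nonneg (hear := hear) N (C s) pos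
        simpa [h0] using this
      · refine (sum_rate_le_gcs_ofHear N (C s) hself hR pos).trans (le_of_eq ?_)
        rw [Finset.mul_sum]
        congr 1
        refine Finset.sum_congr rfl fun v _ => ?_
        have : (n s : ℝ) ≠ 0 := by positivity
        field_simp

variable [∀ i, Fintype (X i)] [∀ i, Fintype (V i)]

/-- The choice `c` is free, so it can be taken to be the copies that a given user hears. -/
theorem termEntropy_inputLaw_eq (c : ∀ j, Fin (m j)) (t : Fin n) (i : Fin 3)
    (T : Finset (Fin 3)) :
    N.termEntropy (C.inputLaw t) i T =
      entropyGiven (uniformLaw (∀ v : ExtUser m, Fin (numMessages n (R v.1))))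
        (fun w => N.output (fun j => C.enc j (w ⟨j, c j⟩) t) i)
        (fun w (j : T) => N.g j (C.enc j (w ⟨j, c j⟩) t)) := by
  rw [DIC.termEntropy, condEntropy_eq fun x => Finset.prod_nonneg fun j _ => inputLaw_nonneg C t j _,
    ← map_uniformLaw_inputs C c t, entropyGiven, ← entropy_comp, ← entropy_comp]

include hself in
/-- The single-letter bound on the generalized cut-set expression: if for each `j ∈ T v` some user
before `v` hears the same copy of `j` as `v`, then `v` contributes at most `H(Y_v | V_{T v})`. -/
theorem gcs_ofHear_le {pos : ExtUser m → ℕ} {T : ExtUser m → Finset (Fin 3)}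
    (hT : ∀ v, ∀ j ∈ T v, ∃ u, pos u < pos v ∧ hear u j = hear v j) :
    (ExtendedNetwork.ofHear hear).gcs N C (CutSequence.ofPos pos) ≤
      ∑ t, ∑ v, N.termEntropy (C.inputLaw t) v.1 (T v) := by
  have hp := uniformLaw_nonneg (∀ v : ExtUser m, Fin (numMessages n (R v.1)))
  rw [gcs_ofHear, Finset.sum_comm]
  refine (sum_layerEntropy_le hp _ _ fun v =>
    Nat.lt_succ_of_le (Finset.le_sup (f := pos) (Finset.mem_univ v))).trans
      (Finset.sum_le_sum fun v _ => ?_)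
  refine (entropyGiven_fintype_pi_le hp _ _).trans (Finset.sum_le_sum fun t _ => ?_)
  rw [termEntropy_inputLaw_eq N C (hear v)]
  simp only [recv_ofHear N C hself]
  refine entropyGiven_le_of_determines hp _ fun w w' h => funext fun j => ?_
  obtain ⟨u, hu, huv⟩ := hT v j j.2
  rw [← huv]
  exact signal_eq_of_past_eq N C hself h hu j t

end Network

/-! ### Schedules -/

section Schedule

variable {X V Y : Fin 3 → Type*} [∀ i, Fintype (Y i)]

/-- The network `N` has an extension with `m i` copies of user `i` and an admissible cut sequence
whose generalized cut-set expression is at most `B`, for which the generalized cut-set bound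
holds. -/
def DIC.HasExtension (N : DIC X V Y) (m : Fin 3 → ℕ)
    (B : ∀ {n : ℕ} {R : Fin 3 → ℝ}, Code X Y n R → ℝ) : Prop :=
  ∃ (E : ExtendedNetwork m) (Ω : CutSequence m),
    (∀ (n : ℕ) (R : Fin 3 → ℝ) (C : Code X Y n R), E.gcs N C Ω ≤ B C) ∧
    ∀ (R : Fin 3 → ℝ) (n : ℕ → ℕ) (C : ∀ s, Code X Y (n s) R),
      (∀ i, 0 ≤ R i) → Tendsto n atTop atTop →
      Tendsto (fun s => N.errorProb (C s)) atTop (𝓝 0) →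
      Tendsto (fun s => E.errorProb N (C s)) atTop (𝓝 0) ∧
      ∃ ε : ℕ → ℝ, Tendsto ε atTop (𝓝 0) ∧
        ∀ s, (n s : ℝ) * ∑ i, (m i : ℝ) * R i ≤ E.gcs N (C s) Ω + n s * ε s

theorem DIC.HasExtension.mono {N : DIC X V Y} {m : Fin 3 → ℕ}
    {B B' : ∀ {n : ℕ} {R : Fin 3 → ℝ}, Code X Y n R → ℝ} (h : N.HasExtension m B)
    (hB : ∀ {n : ℕ} {R : Fin 3 → ℝ} (C : Code X Y n R), B C ≤ B' C) : N.HasExtension m B' := by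
  obtain ⟨E, Ω, h1, h2⟩ := h
  exact ⟨E, Ω, fun n R C => (h1 n R C).trans (hB C), h2⟩

variable [∀ i, Fintype (X i)] [∀ i, Fintype (V i)]

/-- Copies are indexed by natural numbers here, so that a design can be written as a table of
numbers; the ranges become hypotheses. -/
theorem DIC.hasExtension_of_hear (N : DIC X V Y) {m : Fin 3 → ℕ} {hear : Fin 3 → ℕ → Fin 3 → ℕ}
    {pos : Fin 3 → ℕ → ℕ} {T : Fin 3 → ℕ → Finset (Fin 3)}
    (hlt : ∀ i, ∀ r < m i, ∀ j, hear i r j < m j) (hself : ∀ i, ∀ r < m i, hear i r i = r)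
    (hT : ∀ i, ∀ r < m i, ∀ j ∈ T i r,
      ∃ i', ∃ r' < m i', pos i' r' < pos i r ∧ hear i' r' j = hear i r j)
    (B : ∀ {n : ℕ} {R : Fin 3 → ℝ}, Code X Y n R → ℝ)
    (hB : ∀ {n : ℕ} {R : Fin 3 → ℝ} (C : Code X Y n R),
      ∑ t, ∑ i, ∑ r ∈ Finset.range (m i), N.termEntropy (C.inputLaw t) i (T i r) ≤ B C) :
    N.HasExtension m B := by
  let hear' : ExtUser m → ∀ j, Fin (m j) := fun v j => ⟨hear v.1 v.2 j, hlt v.1 v.2 v.2.2 j⟩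
  have hself' : ∀ v, hear' v v.1 = v.2 := fun v => Fin.ext (hself v.1 v.2 v.2.2)
  let pos' : ExtUser m → ℕ := fun v => pos v.1 v.2
  refine ⟨.ofHear hear', .ofPos pos', fun n R C => ?_, ofHear_asymptotics N hself' pos'⟩
  refine (gcs_ofHear_le N C hself' (T := fun v => T v.1 v.2) fun v j hj => ?_).trans
    (le_trans (le_of_eq ?_) (hB C))
  · obtain ⟨i', r', hr', h1, h2⟩ := hT v.1 v.2 v.2.2 j hj
    exact ⟨⟨i', r', hr'⟩, h1, Fin.ext h2⟩
  · refine Finset.sum_congr rfl fun t _ => ?_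
    rw [Fintype.sum_sigma]
    refine Finset.sum_congr rfl fun i _ => ?_
    exact Fin.sum_univ_eq_sum_range (fun r => N.termEntropy (C.inputLaw t) i (T i r)) (m i)

/-- A schedule describes an extended network together with an order of its users: copy `r` of user
`i` has position `pos i r`, it hears copy `ref i r j - 1` of user `j`, and the signals from the
users in `side i r` are known from earlier users.

A periodic schedule describes one of `k` blocks. Besides the blocks there is one more copy of each
user, which comes first. Reference `0` means this copy of user `j`, and references greater than the
number of copies of `j` in a block point to the next block. The copies in the first block with
reference `carry` are heard by the copies outside the blocks. -/
structure Schedule where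
  pos : Fin 3 → ℕ → ℕ
  ref : Fin 3 → ℕ → Fin 3 → ℕ
  side : Fin 3 → ℕ → Finset (Fin 3)
  carry : Fin 3 → ℕ

namespace Schedule

variable (S : Schedule) (a : Fin 3 → ℕ)

/-- References count from 1, because `0` is reserved for the extra copies of periodic schedules. -/
def IsDirect : Prop :=
  ∀ i, ∀ r < a i, S.ref i r i = r + 1 ∧ (∀ j, 0 < S.ref i r j ∧ S.ref i r j ≤ a j) ∧
    ∀ j ∈ S.side i r, ∃ i', ∃ r' < a i', S.pos i' r' < S.pos i r ∧ S.ref i' r' j = S.ref i r j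

/-- A signal is known in one of three ways: it comes from an extra copy, an earlier user of the same
block hears it, or the preceding block hears it as a signal of its successor. Positions below 8 let
block `s` start at `8 * s + 1`, so that blocks do not interleave. -/
def IsPeriodic : Prop :=
  ∀ i, ∀ r < a i, S.ref i r i = r + 1 ∧ S.pos i r < 8 ∧
    ∀ j ∈ S.side i r, S.ref i r j = 0 ∨
      (∃ i', ∃ r' < a i', S.pos i' r' < S.pos i r ∧ S.ref i' r' j = S.ref i r j) ∨
      S.ref i r j = S.carry j ∧ S.carry j ≤ a j ∧ ∃ i', ∃ r' < a i', S.ref i' r' j = S.carry j + a j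

instance : Decidable (S.IsDirect a) := by
  unfold IsDirect
  infer_instance

instance : Decidable (S.IsPeriodic a) := by
  unfold IsPeriodic
  infer_instance

variable {S a}

/-! ### Extended networks built from schedules -/

theorem IsDirect.hasExtension (h : S.IsDirect a) (N : DIC X V Y) :
    N.HasExtension a fun C => ∑ t, ∑ i, ∑ r ∈ Finset.range (a i),
      N.termEntropy (C.inputLaw t) i (S.side i r) := by
  refine N.hasExtension_of_hear (hear := fun i r j => S.ref i r j - 1) (pos := S.pos)
    (fun i r hr j => ?_) (fun i r hr => ?_) (fun i r hr j hj => ?_) _ fun C => le_rfl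
  · have := (h i r hr).2.1 j
    omega
  · simp [(h i r hr).1]
  · obtain ⟨i', r', hr', h1, h2⟩ := (h i r hr).2.2 j hj
    exact ⟨i', r', hr', h1, by rw [h2]⟩

/-- The copy of user `j` with reference `q` from block `s`. -/
def blockRef (a : Fin 3 → ℕ) (k s : ℕ) (j : Fin 3) (q : ℕ) : ℕ :=
  if q = 0 ∨ k * a j < s * a j + q then 0 else s * a j + q

theorem sum_range_mul_mod (f : ℕ → ℝ) (k c : ℕ) :
    ∑ y ∈ Finset.range (k * c), f (y % c) = k * ∑ r ∈ Finset.range c, f r := by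
  induction k with
  | zero => simp
  | succ k ih =>
    rw [Nat.succ_mul, Finset.sum_range_add, ih, Nat.cast_succ, add_mul, one_mul]
    congr 1
    refine Finset.sum_congr rfl fun r hr => ?_
    rw [Nat.mul_comm, Nat.mul_add_mod, Nat.mod_eq_of_lt (Finset.mem_range.1 hr)]

theorem IsPeriodic.hasExtension (h : S.IsPeriodic a) (N : DIC X V Y) (k : ℕ) :
    N.HasExtension (fun i => k * a i + 1) fun C => ∑ t, ((∑ i, N.termEntropy (C.inputLaw t) i ∅) +
      k * ∑ i, ∑ r ∈ Finset.range (a i), N.termEntropy (C.inputLaw t) i (S.side i r)) := by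
  -- Index 0 is the extra copy and `y + 1` is copy `y % a i` of block `y / a i`. References past the
  -- last block fall back to the extra copy; this does not disturb the order, since what is compared
  -- is only whether two users hear the same copy.
  let hear : Fin 3 → ℕ → Fin 3 → ℕ := fun i x j => match x with
    | 0 => if j = i then 0 else blockRef a k 0 j (S.carry j)
    | y + 1 => blockRef a k (y / a i) j (S.ref i (y % a i) j)
  let pos : Fin 3 → ℕ → ℕ := fun i x => match x with
    | 0 => 0
    | y + 1 => y / a i * 8 + S.pos i (y % a i) + 1
  let T : Fin 3 → ℕ → Finset (Fin 3) := fun i x => match x with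
    | 0 => ∅
    | y + 1 => S.side i (y % a i)
  have hne : ∀ j : Fin 3, j ≠ j + 1 := by decide
  have hb : ∀ s j q, blockRef a k s j q < k * a j + 1 := by
    intro s j q
    unfold blockRef
    split_ifs <;> omega
  have hmod : ∀ {i y}, y + 1 < k * a i + 1 → y % a i < a i ∧ y / a i < k := by
    intro i y hy
    have h0 : 0 < a i := by
      by_contra h0
      simp [Nat.eq_zero_of_not_pos h0] at hy
    exact ⟨Nat.mod_lt _ h0, (Nat.div_lt_iff_lt_mul h0).2 (by omega)⟩
  have hdiv : ∀ {i s r}, s < k → r < a i → s * a i + r + 1 < k * a i + 1 ∧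
      (s * a i + r) % a i = r ∧ (s * a i + r) / a i = s := by
    intro i s r hs hr
    refine ⟨?_, ?_, ?_⟩
    · have := Nat.mul_le_mul_right (a i) hs
      rw [Nat.succ_mul] at this
      omega
    · rw [Nat.mul_comm, Nat.mul_add_mod, Nat.mod_eq_of_lt hr]
    · rw [Nat.mul_comm, Nat.mul_add_div (by omega), Nat.div_eq_of_lt hr, add_zero]
  refine N.hasExtension_of_hear (hear := hear) (pos := pos) (T := T) ?_ ?_ ?_ _ ?_
  · rintro i (_ | y) - j
    · simp only [hear]
      split_ifs
      · omega
      · exact hb _ _ _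
    · exact hb _ _ _
  · rintro i (_ | y) hy
    · simp [hear]
    · have h1 := Nat.div_add_mod y (a i)
      rw [Nat.mul_comm] at h1
      simp only [hear, blockRef]
      rw [(h i _ (hmod hy).1).1, if_neg (by omega)]
      omega
  · rintro i (_ | y) hy j hj
    · simp [T] at hj
    · obtain ⟨hr, hs⟩ := hmod hy
      have hv : hear i (y + 1) j = blockRef a k (y / a i) j (S.ref i (y % a i) j) := rfl
      -- The extra copy of `j` itself comes before all blocks and knows its own signal.
      by_cases hz : S.ref i (y % a i) j = 0
      · exact ⟨j, 0, by omega, by simp only [pos]; omega, by simp [hz, hear, blockRef]⟩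
      rcases (h i _ hr).2.2 j hj with h1 | ⟨i', r', hr', h1, h2⟩ | ⟨h1, h2, i', r', hr', h3⟩
      · exact absurd h1 hz
      · obtain ⟨g1, g2, g3⟩ := hdiv hs hr'
        refine ⟨i', _, g1, ?_, ?_⟩
        · simp only [pos, g2, g3]
          omega
        · simp only [hear, g2, g3, h2]
      -- In the first block the carried signal is known from the extra copy of a different user,
      -- here `j + 1`; in later blocks, from the preceding block.
      · rcases Nat.eq_zero_or_eq_succ_pred (y / a i) with h0 | h0
        · refine ⟨j + 1, 0, by omega, by simp only [pos]; omega, ?_⟩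
          simp only [hv, hear, if_neg (hne j), h0, h1]
        · set s := (y / a i).pred with hsdef
          obtain ⟨g1, g2, g3⟩ := hdiv (i := i') (s := s) (by omega) hr'
          refine ⟨i', _, g1, ?_, ?_⟩
          · have := (h i' r' hr').2.1
            simp only [pos, g2, g3]
            omega
          · simp only [hear, g2, g3, h3, h1, blockRef, h0, Nat.succ_mul]
            have e : s * a j + (S.carry j + a j) = s * a j + a j + S.carry j := by ring
            rw [e]
            refine if_congr ?_ rfl rfl
            omega
  · intro n R C
    refine le_of_eq (Finset.sum_congr rfl fun t _ => ?_)
    rw [Finset.mul_sum, ← Finset.sum_add_distrib]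
    refine Finset.sum_congr rfl fun i _ => ?_
    rw [Finset.sum_range_succ', add_comm]
    congr 1
    exact sum_range_mul_mod (fun r => N.termEntropy (C.inputLaw t) i (S.side i r)) k (a i)

/-- The schedule with user `i` renamed to user `σ i`. -/
def relabel (S : Schedule) (σ : Equiv.Perm (Fin 3)) : Schedule where
  pos i := S.pos (σ.symm i)
  ref i r j := S.ref (σ.symm i) r (σ.symm j)
  side i r := (S.side (σ.symm i) r).map σ.toEmbedding
  carry j := S.carry (σ.symm j)

theorem IsDirect.relabel (h : S.IsDirect a) (σ : Equiv.Perm (Fin 3)) :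
    (S.relabel σ).IsDirect fun i => a (σ.symm i) := by
  intro i r hr
  obtain ⟨h1, h2, h3⟩ := h (σ.symm i) r hr
  refine ⟨h1, fun j => h2 _, fun j hj => ?_⟩
  obtain ⟨i', r', h4⟩ := h3 (σ.symm j) (by simpa [Schedule.relabel] using hj)
  exact ⟨σ i', r', by simpa [Schedule.relabel] using h4⟩

theorem IsPeriodic.relabel (h : S.IsPeriodic a) (σ : Equiv.Perm (Fin 3)) :
    (S.relabel σ).IsPeriodic fun i => a (σ.symm i) := by
  intro i r hr
  obtain ⟨h1, h2, h3⟩ := h (σ.symm i) r hr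
  refine ⟨h1, h2, fun j hj => ?_⟩
  rcases h3 (σ.symm j) (by simpa [Schedule.relabel] using hj) with
    h4 | ⟨i', r', h4⟩ | ⟨h4, h5, i', r', h6⟩
  · exact Or.inl h4
  · exact Or.inr (Or.inl ⟨σ i', r', by simpa [Schedule.relabel] using h4⟩)
  · exact Or.inr (Or.inr ⟨h4, h5, σ i', r', by simpa [Schedule.relabel] using h6⟩)

/-- The terms of the bound that a schedule gives. -/
def terms (S : Schedule) (a : Fin 3 → ℕ) : List (Fin 3 × Finset (Fin 3)) :=
  (List.finRange 3).flatMap fun i => (List.range (a i)).map fun r => (i, S.side i r)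

theorem sum_terms (S : Schedule) (a : Fin 3 → ℕ) (F : Fin 3 → Finset (Fin 3) → ℝ) :
    ((S.terms a).map fun t => F t.1 t.2).sum =
      ∑ i, ∑ r ∈ Finset.range (a i), F i (S.side i r) := by
  have h : ∀ (n : ℕ) (f : ℕ → ℝ), ((List.range n).map f).sum = ∑ r ∈ Finset.range n, f r :=
    fun _ _ => rfl
  simp [terms, List.finRange_succ, Fin.sum_univ_three, Function.comp_def, h, add_assoc]

/-- The schedule proves the bound. -/
def Proves (S : Schedule) (b : OuterBound) : Prop :=
  (if b.viaLimit then S.IsPeriodic b.rate else S.IsDirect b.rate) ∧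
    ∀ F : Fin 3 → Finset (Fin 3) → ℝ, (b.terms.map fun t => F t.1 t.2).sum =
      ∑ i, ∑ r ∈ Finset.range (b.rate i), F i (S.side i r)

theorem Proves.relabel {b : OuterBound} (h : S.Proves b) (σ : Equiv.Perm (Fin 3)) :
    (S.relabel σ).Proves (b.relabel σ) := by
  obtain ⟨h1, h2⟩ := h
  constructor
  · cases hb : b.viaLimit
    · simp only [hb, OuterBound.relabel, Bool.false_eq_true, if_false] at h1 ⊢
      exact h1.relabel σ
    · simp only [hb, OuterBound.relabel, if_true] at h1 ⊢
      exact h1.relabel σ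
  · intro F
    have := h2 fun i T => F (σ i) (T.map σ.toEmbedding)
    simp only [OuterBound.relabel, List.map_map, Function.comp_def, this]
    refine Eq.trans ?_ (Equiv.sum_comp σ _)
    simp [Schedule.relabel]

theorem Proves.hasExtension {b : OuterBound} (h : S.Proves b) (N : DIC X V Y) (k : ℕ) :
    N.HasExtension (b.copies k) (b.singleLetter N k) := by
  obtain ⟨rate, terms, lim⟩ := b
  obtain ⟨h1, h2⟩ := h
  have h3 : ∀ p, OuterBound.rhs ⟨rate, terms, lim⟩ N p = ∑ i, ∑ r ∈ Finset.range (rate i),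
      N.termEntropy p i (S.side i r) := fun p => h2 (N.termEntropy p)
  cases lim
  · have h4 : S.IsDirect rate := by simpa using h1
    exact (h4.hasExtension N).mono fun C => by simp [OuterBound.singleLetter, h3]
  · have h4 : S.IsPeriodic rate := by simpa using h1
    exact (h4.hasExtension N k).mono fun C => by
      simp [OuterBound.singleLetter, h3, Finset.sum_add_distrib, add_comm]

/-- The schedule for the bound in which copy `r` of user `i` has position and references
`table i r`. -/
def ofTable (b : OuterBound) (table : Fin 3 → List (List ℕ)) (carry : Fin 3 → ℕ) : Schedule where
  pos i r := ((table i).getD r []).getD 0 0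
  ref i r j := ((table i).getD r []).getD (j + 1) 0
  side i r := ((b.terms.filter (·.1 = i)).map (·.2)).getD r ∅
  carry := carry

/-- A decidable form of `Schedule.Proves`. -/
def Checks (b : OuterBound) (S : Schedule) : Prop :=
  (if b.viaLimit then S.IsPeriodic b.rate else S.IsDirect b.rate) ∧ b.terms = S.terms b.rate

instance (b : OuterBound) (S : Schedule) : Decidable (Checks b S) := by
  unfold Checks
  infer_instance

/-- Equality of lists is decidable but depends on the order of the users. The equality of sums in
`Proves` does not, and so survives relabelling. -/
theorem Checks.proves {b : OuterBound} (h : Checks b S) : S.Proves b :=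
  ⟨h.1, fun F => by rw [h.2, sum_terms]⟩

/-- A row reads `[position, reference to user 0, to user 1, to user 2]`. The rows of a user follow
the order of its terms in the bound, from which `ofTable` takes the side information. -/
theorem exists_checks : ∀ b ∈ outerBounds, ∃ table carry, Checks b (ofTable b table carry) := by
  simp only [outerBounds, List.forall_mem_cons, List.not_mem_nil, false_imp_iff, implies_true,
    and_true]
  exact ⟨
    -- All copies of user 0 in the blocks hear the same extra copies of users 1 and 2, whose signals
    -- are known from the start.
    ⟨![[[0, 1, 0, 0]], [], []], ![0, 0, 0], by decide⟩,
    ⟨![[[1, 1, 0, 0]], [[0, 1, 1, 0]], []], ![0, 0, 0], by decide⟩,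
    -- A chain: user 1 of a block hears user 0 of the next block (reference `2 = 1 + a_0`) and is
    -- itself heard by user 0 of its own block. The carry 1 lets the extra copies hear the first
    -- user 0.
    ⟨![[[0, 1, 1, 0]], [[1, 2, 1, 0]], []], ![1, 0, 0], by decide⟩,
    ⟨![[[0, 1, 1, 0], [2, 2, 0, 0]], [[1, 2, 1, 0]], []], ![0, 0, 0], by decide⟩,
    ⟨![[[0, 1, 1, 1]], [[1, 2, 1, 0]], [[2, 0, 0, 1]]], ![1, 0, 0], by decide⟩,
    ⟨![[[0, 1, 1, 0]], [[1, 0, 1, 1]], [[2, 2, 0, 1]]], ![1, 0, 0], by decide⟩,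
    ⟨![[[2, 1, 0, 0]], [[0, 0, 1, 1]], [[1, 1, 0, 1]]], ![0, 0, 0], by decide⟩,
    -- The original channel itself: user 2 comes first without side information and thereby reveals
    -- all three signals.
    ⟨![[[1, 1, 1, 1]], [[2, 1, 1, 1]], [[0, 1, 1, 1]]], ![0, 0, 0], by decide⟩,
    ⟨![[[0, 1, 1, 1], [2, 2, 1, 1]], [[1, 2, 1, 1]], [[3, 1, 1, 1]]], ![0, 0, 0], by decide⟩,
    ⟨![[[0, 1, 1, 1], [2, 2, 0, 0]], [[1, 2, 1, 0]], [[3, 3, 0, 1]]], ![1, 0, 0], by decide⟩,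
    ⟨![[[2, 1, 1, 0], [0, 2, 0, 1]], [[3, 0, 1, 0]], [[1, 1, 0, 1]]], ![0, 0, 0], by decide⟩,
    ⟨![[[3, 1, 0, 0], [0, 2, 1, 0]], [[1, 0, 1, 1]], [[2, 1, 0, 1]]], ![0, 0, 0], by decide⟩,
    ⟨![[[2, 1, 0, 0], [0, 2, 1, 0]], [[1, 1, 1, 1]], [[3, 0, 0, 1]]], ![0, 0, 0], by decide⟩,
    ⟨![[[2, 1, 0, 0], [0, 2, 0, 1]], [[3, 4, 1, 0]], [[1, 1, 1, 1]]], ![2, 0, 0], by decide⟩,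
    ⟨![[[1, 1, 1, 1], [3, 2, 1, 1]], [[0, 1, 1, 1]], [[2, 2, 1, 1]]], ![0, 0, 0], by decide⟩,
    ⟨![[[1, 1, 0, 0], [3, 2, 0, 0]], [[0, 1, 1, 1]], [[2, 2, 2, 1]]], ![0, 1, 0], by decide⟩,
    ⟨![[[2, 1, 1, 1], [4, 2, 1, 1], [0, 3, 1, 1]], [[1, 1, 1, 1]], [[3, 2, 1, 1]]], ![0, 0, 0], by decide⟩,
    ⟨![[[2, 1, 0, 0], [4, 2, 0, 0], [0, 3, 0, 1]], [[3, 2, 1, 0]], [[1, 1, 1, 1]]], ![0, 0, 0], by decide⟩,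
    ⟨![[[0, 1, 1, 1], [3, 2, 2, 1]], [[1, 1, 1, 1], [4, 1, 2, 1]], [[2, 2, 1, 1]]], ![0, 0, 0], by decide⟩,
    ⟨![[[0, 1, 1, 1], [4, 2, 1, 1]], [[1, 1, 1, 1], [3, 2, 2, 1]], [[2, 1, 2, 1]]], ![0, 0, 0], by decide⟩,
    ⟨![[[0, 1, 1, 1], [3, 2, 1, 1]], [[1, 1, 1, 1], [4, 1, 2, 1]], [[2, 2, 2, 1]]], ![0, 0, 0], by decide⟩,
    ⟨![[[0, 1, 1, 1], [3, 2, 0, 0]], [[1, 0, 1, 0], [4, 3, 2, 0]], [[2, 2, 2, 1]]], ![1, 0, 0], by decide⟩,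
    ⟨![[[0, 1, 2, 0], [2, 2, 1, 0]], [[3, 0, 1, 0], [1, 2, 2, 1]], [[4, 3, 0, 1]]], ![1, 0, 0], by decide⟩,
    ⟨![[[3, 1, 1, 1], [5, 2, 1, 1], [0, 3, 1, 1]], [[1, 3, 1, 1], [4, 2, 2, 1]], [[2, 1, 2, 1]]], ![0, 0, 0], by decide⟩,
    ⟨![[[2, 1, 1, 1], [5, 2, 1, 1], [0, 3, 1, 1]], [[1, 1, 1, 1], [4, 2, 2, 1]], [[3, 1, 2, 1]]], ![0, 0, 0], by decide⟩,
    ⟨![[[2, 1, 0, 0], [4, 2, 0, 0], [0, 3, 1, 1]], [[1, 1, 1, 0], [5, 6, 2, 0]], [[3, 2, 2, 1]]], ![3, 0, 0], by decide⟩,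
    ⟨![[[1, 1, 2, 1], [3, 2, 1, 1], [5, 3, 1, 1]], [[4, 3, 1, 1], [0, 1, 2, 1]], [[2, 2, 1, 1]]], ![0, 0, 0], by decide⟩,
    ⟨![[[2, 1, 1, 1], [4, 2, 1, 1], [6, 3, 1, 1], [0, 4, 1, 1]], [[1, 1, 1, 1], [5, 3, 2, 1]], [[3, 2, 2, 1]]], ![0, 0, 0], by decide⟩⟩

end Schedule

end Schedule

/-! ### Time sharing -/

section TimeSharing

/-- Convex combinations of `d` points of `s`. -/
def convexCombinations {E : Type*} [AddCommGroup E] [Module ℝ E] (d : ℕ) (s : Set E) : Set E :=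
  (fun x : (Fin d → ℝ) × (Fin d → E) => ∑ i, x.1 i • x.2 i) ''
    (stdSimplex ℝ (Fin d) ×ˢ Set.univ.pi fun _ => s)

theorem IsCompact.convexCombinations {E : Type*} [NormedAddCommGroup E] [NormedSpace ℝ E]
    {s : Set E} (hs : IsCompact s) (d : ℕ) : IsCompact (convexCombinations d s) :=
  ((isCompact_stdSimplex ℝ (Fin d)).prod (isCompact_univ_pi fun _ => hs)).image (by fun_prop)

/-- Carathéodory's theorem with a fixed number of points. -/
theorem convexHull_subset_convexCombinations {E : Type*} [AddCommGroup E] [Module ℝ E]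
    [FiniteDimensional ℝ E] (s : Set E) :
    convexHull ℝ s ⊆ convexCombinations (Module.finrank ℝ E + 1) s := by
  intro x hx
  obtain ⟨x₀, h₀⟩ : s.Nonempty := convexHull_nonempty_iff.1 ⟨x, hx⟩
  obtain ⟨ι, _, z, w, hz, hind, hw, hw1, rfl⟩ := eq_pos_convex_span_of_mem_convexHull hx
  have hcard : Fintype.card ι ≤ Fintype.card (Fin (Module.finrank ℝ E + 1)) := by
    rw [Fintype.card_fin]
    exact hind.card_le_finrank_succ.trans
      (Nat.succ_le_succ (Submodule.finrank_le _))
  obtain ⟨e⟩ := Function.Embedding.nonempty_of_card_le hcard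
  have hext : ∀ i ∉ Set.range e, Function.extend e w 0 i = 0 := fun i hi =>
    Function.extend_apply' _ _ _ fun ⟨a, ha⟩ => hi ⟨a, ha⟩
  -- Fewer than the fixed number of points are padded with copies of `x₀` of weight 0.
  refine ⟨(Function.extend e w 0, Function.extend e z fun _ => x₀), ⟨⟨fun i => ?_, ?_⟩, ?_⟩, ?_⟩
  · by_cases hi : i ∈ Set.range e
    · obtain ⟨a, rfl⟩ := hi
      simpa [e.injective.extend_apply] using (hw a).le
    · exact (hext i hi).ge
  · rw [← hw1]
    exact (Fintype.sum_of_injective e e.injective w _ hext fun i => by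
      simp [e.injective.extend_apply]).symm
  · intro i _
    by_cases hi : i ∈ Set.range e
    · obtain ⟨a, rfl⟩ := hi
      simpa [e.injective.extend_apply] using hz ⟨a, rfl⟩
    · simpa [Function.extend_apply' _ _ _ fun ⟨a, ha⟩ => hi ⟨a, ha⟩] using h₀
  · exact (Fintype.sum_of_injective e e.injective (fun i => w i • z i) _
      (fun i hi => by simp [hext i hi]) fun i => by simp [e.injective.extend_apply]).symm

/-! ### Continuity of the entropies and compactness of time sharing -/

theorem condEntropy_eq_sum_negMulLog {Ω α β : Type*} [Fintype Ω] [Fintype α] [Fintype β]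
    {p : Ω → ℝ} (hp : ∀ ω, 0 ≤ p ω) (A : Ω → α) (B : Ω → β) :
    condEntropy p A B = ((∑ x : α × β, Real.negMulLog (probOf p {ω | (A ω, B ω) = x})) -
      ∑ b, Real.negMulLog (probOf p {ω | B ω = b})) / Real.log 2 := by
  rw [condEntropy_eq hp, entropy_eq_sum_negMulLog, entropy_eq_sum_negMulLog, sub_div]

theorem continuous_probOf {Ω : Type*} [Fintype Ω] (s : Set Ω) :
    Continuous fun p : Ω → ℝ => probOf p s := by
  classical
  have : (fun p : Ω → ℝ => probOf p s) = fun p => ∑ ω, if ω ∈ s then p ω else 0 :=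
    funext fun p => probOf_setOf p (· ∈ s)
  rw [this]
  refine continuous_finsetSum _ fun ω _ => ?_
  split_ifs <;> fun_prop

variable {X V Y : Fin 3 → Type*} [∀ i, Fintype (X i)]

/-- The laws of independent channel inputs. -/
def inputLaws (X : Fin 3 → Type*) [∀ i, Fintype (X i)] : Set (∀ i, X i → ℝ) :=
  Set.univ.pi fun i => stdSimplex ℝ (X i)

theorem inputLaw_mem_inputLaws {n : ℕ} {R : Fin 3 → ℝ} (C : Code X Y n R) (t : Fin n) :
    C.inputLaw t ∈ inputLaws X := by
  intro i _
  refine ⟨inputLaw_nonneg C t i, ?_⟩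
  have := sum_probOf_mul (uniformLaw (Fin (numMessages n (R i)))) (fun w => C.enc i w t)
    fun _ => 1
  simpa [sum_uniformLaw, Code.inputLaw] using this

variable [∀ i, Fintype (V i)] [∀ i, Fintype (Y i)] (N : DIC X V Y)

/-- All the entropies `H(Y_i | V_T)`. -/
noncomputable def DIC.entropyVector (p : ∀ i, X i → ℝ) (t : Fin 3 × Finset (Fin 3)) : ℝ :=
  N.termEntropy p t.1 t.2

/-- The form with `Real.negMulLog` is continuous even where probabilities vanish. It agrees with the
conditional entropy for nonnegative weights, hence on `inputLaws X`. -/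
theorem continuousOn_entropyVector : ContinuousOn N.entropyVector (inputLaws X) := by
  refine continuousOn_pi.2 fun t => ?_
  have h : Continuous fun (p : ∀ i, X i → ℝ) (x : ∀ i, X i) => ∏ i, p i (x i) := by fun_prop
  have hP : ∀ s : Set (∀ i, X i), Continuous fun p : ∀ i, X i → ℝ =>
      probOf (fun x : ∀ i, X i => ∏ i, p i (x i)) s := fun s => (continuous_probOf s).comp h
  refine ContinuousOn.congr (Continuous.continuousOn ?_) fun p hp =>
    condEntropy_eq_sum_negMulLog (fun x => Finset.prod_nonneg fun i _ => (hp i trivial).1 _) _ _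
  exact ((continuous_finsetSum _ fun _ _ => Real.continuous_negMulLog.comp (hP _)).sub
    (continuous_finsetSum _ fun _ _ => Real.continuous_negMulLog.comp (hP _))).div_const _

/-- The vectors of entropies that can be obtained with time sharing. -/
def DIC.timeSharing : Set (Fin 3 × Finset (Fin 3) → ℝ) :=
  convexCombinations (Module.finrank ℝ (Fin 3 × Finset (Fin 3) → ℝ) + 1)
    (N.entropyVector '' inputLaws X)

theorem isCompact_timeSharing : IsCompact N.timeSharing :=
  ((isCompact_univ_pi fun i => isCompact_stdSimplex ℝ (X i)).image_of_continuousOn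
    (continuousOn_entropyVector N)).convexCombinations _

/-- The value of a sum of entropies at a vector of entropies. -/
def sumTerms (l : List (Fin 3 × Finset (Fin 3))) (v : Fin 3 × Finset (Fin 3) → ℝ) : ℝ :=
  (l.map v).sum

theorem continuous_sumTerms (l : List (Fin 3 × Finset (Fin 3))) : Continuous (sumTerms l) := by
  induction l with
  | nil => exact continuous_const
  | cons a l ih => exact (continuous_apply a).add ih

theorem sumTerms_sum_smul {ι : Type*} (s : Finset ι) (l : List (Fin 3 × Finset (Fin 3)))
    (w : ι → ℝ) (v : ι → Fin 3 × Finset (Fin 3) → ℝ) :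
    sumTerms l (∑ i ∈ s, w i • v i) = ∑ i ∈ s, w i * sumTerms l (v i) := by
  induction l with
  | nil => simp [sumTerms]
  | cons a l ih =>
    simp only [sumTerms, List.map_cons, List.sum_cons] at ih ⊢
    simp [ih, mul_add, Finset.sum_add_distrib]

theorem rhs_eq_sumTerms (b : OuterBound) (p : ∀ i, X i → ℝ) :
    b.rhs N p = sumTerms b.terms (N.entropyVector p) := rfl

/-- The average over time of the entropies of a code. -/
noncomputable def DIC.meanEntropy {n : ℕ} {R : Fin 3 → ℝ} (C : Code X Y n R) :
    Fin 3 × Finset (Fin 3) → ℝ :=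
  ∑ t, (n : ℝ)⁻¹ • N.entropyVector (C.inputLaw t)

/-- The time index is a time-sharing variable with `n` values; Carathéodory's theorem makes their
number independent of `n`. -/
theorem meanEntropy_mem_timeSharing {n : ℕ} {R : Fin 3 → ℝ} (C : Code X Y n R) (hn : 0 < n) :
    N.meanEntropy C ∈ N.timeSharing := by
  refine convexHull_subset_convexCombinations _ ((convex_convexHull ℝ _).sum_mem
    (fun t _ => by positivity) ?_ fun t _ => subset_convexHull ℝ _ ⟨_, inputLaw_mem_inputLaws C t, rfl⟩)
  have : (n : ℝ) ≠ 0 := by positivity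
  simp [this]

theorem sum_sumTerms_eq {n : ℕ} {R : Fin 3 → ℝ} (C : Code X Y n R)
    (l : List (Fin 3 × Finset (Fin 3))) :
    ∑ t, sumTerms l (N.entropyVector (C.inputLaw t)) = n * sumTerms l (N.meanEntropy C) := by
  rcases Nat.eq_zero_or_pos n with rfl | hn
  · simp
  · have : (n : ℝ) ≠ 0 := by positivity
    rw [DIC.meanEntropy, sumTerms_sum_smul, ← Finset.mul_sum, ← mul_assoc, mul_inv_cancel₀ this,
      one_mul]

/-- The single-letter bound as a function of the entropies. -/
def OuterBound.value (b : OuterBound) (k : ℕ) (v : Fin 3 × Finset (Fin 3) → ℝ) : ℝ :=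
  if b.viaLimit then k * sumTerms b.terms v + sumTerms [(0, ∅), (1, ∅), (2, ∅)] v
  else sumTerms b.terms v

theorem singleLetter_eq (b : OuterBound) (k : ℕ) {n : ℕ} {R : Fin 3 → ℝ} (C : Code X Y n R) :
    b.singleLetter N k C = n * b.value k (N.meanEntropy C) := by
  unfold OuterBound.singleLetter OuterBound.value
  split_ifs
  · simp only [rhs_eq_sumTerms]
    rw [← Finset.mul_sum, sum_sumTerms_eq, mul_add, ← sum_sumTerms_eq N C [(0, ∅), (1, ∅), (2, ∅)]]
    congr 1
    ring
  · simp only [rhs_eq_sumTerms]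
    exact sum_sumTerms_eq N C _

theorem continuous_value (b : OuterBound) (k : ℕ) : Continuous (b.value k) := by
  unfold OuterBound.value
  have := continuous_sumTerms
  split_ifs <;> fun_prop

/-- For a limit bound, a positive violation would be multiplied by `k`, while the contribution of
the extra copies stays fixed; a large `k` gives a contradiction. -/
theorem le_sumTerms_of_copies_le {b : OuterBound} {R : Fin 3 → ℝ}
    {v : Fin 3 × Finset (Fin 3) → ℝ} (hR : ∀ i, 0 ≤ R i)
    (h : ∀ k, ∑ i, (b.copies k i : ℝ) * R i ≤ b.value k v) :
    ∑ i, (b.rate i : ℝ) * R i ≤ sumTerms b.terms v := by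
  cases hb : b.viaLimit
  · simpa [OuterBound.copies, OuterBound.value, hb] using h 0
  · by_contra! hlt
    obtain ⟨k, hk⟩ := exists_nat_gt (sumTerms [(0, ∅), (1, ∅), (2, ∅)] v /
      (∑ i, (b.rate i : ℝ) * R i - sumTerms b.terms v))
    rw [div_lt_iff₀ (sub_pos.2 hlt)] at hk
    have h1 := h k
    simp only [OuterBound.copies, OuterBound.value, hb, if_true, Nat.cast_add, Nat.cast_mul,
      Nat.cast_one, add_mul, one_mul, Finset.sum_add_distrib, mul_assoc, ← Finset.mul_sum] at h1
    have h2 := Finset.sum_nonneg fun i (_ : i ∈ Finset.univ) => hR i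
    linarith

/-- An achievable rate tuple satisfies every bound that has extensions for all `k`, with a common
vector of entropies. -/
theorem exists_mem_timeSharing_of_isAchievable {R : Fin 3 → ℝ} (hR : N.IsAchievable R) :
    ∃ v ∈ N.timeSharing, ∀ b : OuterBound,
      (∀ k, N.HasExtension (b.copies k) (b.singleLetter N k)) →
        ∑ i, (b.rate i : ℝ) * R i ≤ sumTerms b.terms v := by
  obtain ⟨hR0, hR⟩ := hR
  -- The lower bound `s + 1` makes the block lengths positive as well as unbounded.
  choose n hn C hC using fun s : ℕ => hR (1 / ((s : ℝ) + 1)) (by positivity) (s + 1)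
  have hnpos : ∀ s, 0 < n s := fun s => (Nat.succ_pos s).trans_le (hn s)
  have hn' : Tendsto n atTop atTop :=
    tendsto_atTop_mono (fun s => (Nat.le_succ s).trans (hn s)) tendsto_id
  have hC' : Tendsto (fun s => N.errorProb (C s)) atTop (𝓝 0) :=
    squeeze_zero (fun s => probOf_nonneg (uniformLaw_nonneg _) _) hC
      tendsto_one_div_add_atTop_nhds_zero_nat
  -- The subsequence is fixed before any bound or `k` is chosen, so the same `v` serves all of them.
  obtain ⟨v, hv, φ, hφ, hlim⟩ := (isCompact_timeSharing N).tendsto_subseq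
    fun s => meanEntropy_mem_timeSharing N (C s) (hnpos s)
  refine ⟨v, hv, fun b hb => le_sumTerms_of_copies_le hR0 fun k => ?_⟩
  obtain ⟨E, Ω, h1, h2⟩ := hb k
  obtain ⟨-, ε, hε, h3⟩ := h2 R n C hR0 hn' hC'
  have h4 : ∀ s, ∑ i, (b.copies k i : ℝ) * R i ≤ b.value k (N.meanEntropy (C s)) + ε s := by
    intro s
    have h5 := (h3 s).trans (add_le_add_left (h1 _ _ (C s)) _)
    simp only [singleLetter_eq, ← mul_add] at h5
    exact le_of_mul_le_mul_left h5 (by exact_mod_cast hnpos s)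
  have h6 := (((continuous_value b k).tendsto v).comp hlim).add (hε.comp hφ.tendsto_atTop)
  rw [add_zero] at h6
  exact ge_of_tendsto' h6 fun s => h4 (φ s)

/-- The vectors found for approximating achievable tuples have a limit point in the compact set, and
both sides of each bound are continuous. -/
theorem exists_mem_timeSharing_of_mem_capacityRegion {R : Fin 3 → ℝ}
    (hR : R ∈ N.capacityRegion) :
    ∃ v ∈ N.timeSharing, ∀ b : OuterBound,
      (∀ k, N.HasExtension (b.copies k) (b.singleLetter N k)) →
        ∑ i, (b.rate i : ℝ) * R i ≤ sumTerms b.terms v := by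
  obtain ⟨r, hr, hlim⟩ := mem_closure_iff_seq_limit.1 hR
  choose v hv h using fun s => exists_mem_timeSharing_of_isAchievable N (hr s)
  obtain ⟨v', hv', φ, hφ, hlim'⟩ := (isCompact_timeSharing N).tendsto_subseq hv
  refine ⟨v', hv', fun b hb => le_of_tendsto_of_tendsto' (tendsto_finsetSum _ fun i _ =>
    ((tendsto_pi_nhds.1 (hlim.comp hφ.tendsto_atTop) i).const_mul (b.rate i : ℝ)))
    (((continuous_sumTerms b.terms).tendsto v').comp hlim') fun s => h (φ s) b hb⟩

end TimeSharing

/-! ### Both statements for all permutations of the users -/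

theorem mainTheorem3 {X V Y : Fin 3 → Type*} [∀ i, Fintype (X i)] [∀ i, Fintype (V i)]
    [∀ i, Fintype (Y i)] (N : DIC X V Y) :
    (∀ b ∈ outerBounds, ∀ σ : Equiv.Perm (Fin 3), ∀ k : ℕ,
      ∃ (E : ExtendedNetwork ((b.relabel σ).copies k))
        (Ω : CutSequence ((b.relabel σ).copies k)),
        (∀ (n : ℕ) (R : Fin 3 → ℝ) (C : Code X Y n R),
          E.gcs N C Ω ≤ (b.relabel σ).singleLetter N k C) ∧
        ∀ (R : Fin 3 → ℝ) (n : ℕ → ℕ) (C : ∀ s, Code X Y (n s) R),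
          (∀ i, 0 ≤ R i) → Tendsto n atTop atTop →
          Tendsto (fun s => N.errorProb (C s)) atTop (𝓝 0) →
          Tendsto (fun s => E.errorProb N (C s)) atTop (𝓝 0) ∧
          ∃ ε : ℕ → ℝ, Tendsto ε atTop (𝓝 0) ∧
            ∀ s, (n s : ℝ) * ∑ i, ((b.relabel σ).copies k i : ℝ) * R i ≤
              E.gcs N (C s) Ω + n s * ε s) ∧
    ∀ R ∈ N.capacityRegion,
      ∃ (q : ℕ) (τ : Fin q → ℝ) (p : Fin q → ∀ i, X i → ℝ),
        τ ∈ stdSimplex ℝ (Fin q) ∧ (∀ s i, p s i ∈ stdSimplex ℝ (X i)) ∧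
        ∀ b ∈ outerBounds, ∀ σ : Equiv.Perm (Fin 3),
          ∑ i, ((b.relabel σ).rate i : ℝ) * R i ≤ ∑ s, τ s * (b.relabel σ).rhs N (p s) := by
  have key : ∀ b ∈ outerBounds, ∀ σ : Equiv.Perm (Fin 3), ∀ k : ℕ,
      N.HasExtension ((b.relabel σ).copies k) ((b.relabel σ).singleLetter N k) := by
    intro b hb σ k
    obtain ⟨table, carry, h⟩ := Schedule.exists_checks b hb
    exact (h.proves.relabel σ).hasExtension N k
  refine ⟨key, fun R hR => ?_⟩
  -- Unfolding membership in `N.timeSharing` yields the law `τ` of the time-sharing variable and,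
  -- for each of its values, an entropy vector that comes from independent inputs.
  obtain ⟨v, ⟨⟨τ, z⟩, ⟨hτ, hz⟩, rfl⟩, hv⟩ := exists_mem_timeSharing_of_mem_capacityRegion N hR
  choose p hp hpz using fun s => hz s trivial
  refine ⟨_, τ, p, hτ, fun s i => hp s i trivial, fun b hb σ => ?_⟩
  refine (hv _ (key b hb σ)).trans (le_of_eq ?_)
  simp only [sumTerms_sum_smul, rhs_eq_sumTerms, hpz]
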